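/- Throughout, $R$ is a commutative ring in which $2$ is invertible and $I$ is an ideal of $R$. The bilinear form of a quadratic form $q$ is $\langle x,y\rangle = q(x+y)-q(x)-q(y)$, and $q$ is called non-degenerate if $d\colon z\mapsto\langle z,\cdot\rangle$ is an isomorphism onto the dual module. For a finitely generated projective module $P$, the hyperbolic space $\mathbb H(P)$ is $P\oplus P^*$ with $\langle (x_1,f_1),(x_2,f_2)\rangle_h=f_2(x_1)+f_1(x_2)$. The standard matrix $\tilde\phi_N$ is $\tilde\psi_r$ if $N=2r$ and $2\perp\tilde\psi_r$ if $N=2r+1$, where $\tilde\psi_r$ is the orthogonal sum of $r$ blocks $\begin{pmatrix}0&1\\1&0\end{pmatrix}$. *Transvection groups.* For a quadratic module $(M,\langle\,,\,\rangle,q)$ and $u,v\in M$ with $u$ unimodular, $q(u)=0$ and $\langle u,v\rangle=0$, put $\sigma_{u,v}(x)=x+\langle v,x\rangle u-\langle u,x\rangle v-q(v)\langle u,x\rangle u$. The group $\mathrm{TransO}(M,\langle\,,\,\rangle)$ is generated by all $\sigma_{u,v}$, and $\mathrm{TransO}(M,IM,\langle\,,\,\rangle)$ is the normal closure in it of the group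 generated by those $\sigma_{u,v}$ with $v\in IM$. *DSER groups.* Let $(Q,q)$ be non-degenerate and $M=Q\perp\mathbb H(P)$. For linear $\alpha\colon Q\to P$ and $\beta\colon Q\to P^*$ put $\alpha^*=d^{-1}\circ\alpha^t\colon P^*\to Q$, $\beta^*=d^{-1}\circ\beta^t\circ i\colon P\to Q$ (with $i\colon P\to P^{**}$ the natural map), and $$E_\alpha(z,x,f)=\bigl(z-\alpha^*(f),\;x+\alpha(z)-\tfrac12\alpha\alpha^*(f),\;f\bigr),\qquad E^*_\beta(z,x,f)=\bigl(z-\beta^*(x),\;x,\;f+\beta(z)-\tfrac12\beta\beta^*(x)\bigr).$$ The group $\mathrm{EO}_R(Q,\mathbb H(P))$ is generated by all $E_\alpha,E^*_\beta$, and $\mathrm{EO}_{(R,I)}(Q,\mathbb H(P))$ is the normal closure in it of the group generated by the $E_\alpha,E^*_\beta$ with $\alpha(Q)\subseteq IP$, $\beta(Q)\subseteq IP^*$. **Theorem.** Let $n\ge 1$ and $m\ge 2$. Let $(Q,q)$ be a non-degenerate quadratic module, finitely generated projective of constant rank $n$, and let $P$ be a finitely generated projective module of constant rank $m$. Let $M$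 be a quadratic module with form $\langle\,,\,\rangle_{\varphi'}$ and with an orthogonal decomposition $M=Q\perp\mathbb H(P)$ (that is, with a given isometry $Q\perp\mathbb H(P)\cong M$). Assume that $M$ has hyperbolic rank at least $m$, i.e. contains an isometric copy of $\mathbb H(R)^m$. Let $\varphi'=\epsilon^t\,\tilde\phi_{n+2m}\,\epsilon$ with $\epsilon\in\mathrm{GL}_{n+2m}(R)$, and assume that for every maximal ideal $\mathfrak m$ of $R$ the localized form on $M_{\mathfrak m}$ has the matrix $\varphi'$ with respect to some basis of $M_{\mathfrak m}$. Then, as groups of automorphisms of $M$, $$\mathrm{TransO}(M,IM,\langle\,,\,\rangle_{\varphi'})=\mathrm{EO}_{(R,I)}(Q,\mathbb H(P))_{\varphi'},$$ where the right-hand side is the relative DSER group for the decomposition $M=Q\perp\mathbb H(P)$. -/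

import Mathlib

open scoped TensorProduct

/-- The standard symmetric matrix of size `n`: it is `ψ_r` for `n = 2 r` and `2 ⊥ ψ_r` for
`n = 2 r + 1`, where `ψ_r` is the orthogonal sum of `r` blocks `[[0, 1], [1, 0]]`. -/
def stdForm (R : Type*) [CommRing R] (n : ℕ) : Matrix (Fin n) (Fin n) R :=
  Matrix.of fun i j =>
    if Even n then
      (if i.1 / 2 = j.1 / 2 ∧ i ≠ j then 1 else 0)
    else
      (if i.1 = 0 ∧ j.1 = 0 then 2
       else if (i.1 + 1) / 2 = (j.1 + 1) / 2 ∧ i ≠ j then 1 else 0)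

/-- For subgroups `H ≤ G` of a group `A`: the normal closure of `H` in `G`, as a subgroup of `A`. -/
def normalClosureIn {A : Type*} [Group A] (H G : Subgroup A) : Subgroup A :=
  (Subgroup.normalClosure ((H.subgroupOf G : Subgroup G) : Set G)).map G.subtype

namespace QuadSpace

/-! The bilinear form associated with a quadratic form `q` is the polar form
`⟨x, y⟩ = q (x + y) - q x - q y`, that is `q.polarBilin x y`; so `⟨x, x⟩ = 2 q x`. -/

section Transvection

variable {R M : Type*} [CommRing R] [AddCommGroup M] [Module R M]

/-- `u` is a unimodular element: some linear form takes the value `1` at `u`. -/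
def IsUnimodular (R : Type*) {M : Type*} [CommRing R] [AddCommGroup M] [Module R M] (u : M) :
    Prop :=
  ∃ f : Module.Dual R M, f u = 1

/-- The Eichler-Siegel-Dickson transformation
`σ_{u,v} (x) = x + ⟨v, x⟩ u - ⟨u, x⟩ v - q(v) ⟨u, x⟩ u`. -/
def esd (q : QuadraticForm R M) (u v x : M) : M :=
  x + q.polarBilin v x • u - q.polarBilin u x • v - (q v * q.polarBilin u x) • u

/-- The group generated by the transvections `σ_{u,v}` with `u` unimodular, `q(u) = 0`,
`⟨u, v⟩ = 0` and `v ∈ J M`. -/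
def transOTrue (q : QuadraticForm R M) (J : Ideal R) : Subgroup (M ≃ₗ[R] M) :=
  Subgroup.closure
    {g | ∃ u v : M, IsUnimodular R u ∧ q u = 0 ∧ q.polarBilin u v = 0 ∧
      v ∈ J • (⊤ : Submodule R M) ∧ ∀ x, g x = esd q u v x}

/-- The Eichler-Siegel-Dickson transvection group `TransO(M, ⟨,⟩)`. -/
def transO (q : QuadraticForm R M) : Subgroup (M ≃ₗ[R] M) :=
  transOTrue q ⊤

/-- The relative transvection group `TransO(M, IM, ⟨,⟩)`: the normal closure in `TransO(M, ⟨,⟩)`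
of the group generated by the `σ_{u,v}` with `v ∈ I M`. -/
def transORel (q : QuadraticForm R M) (I : Ideal R) : Subgroup (M ≃ₗ[R] M) :=
  normalClosureIn (transOTrue q I) (transO q)

end Transvection

section DSER

variable {R Q P M : Type*} [CommRing R] [AddCommGroup Q] [Module R Q]
  [AddCommGroup P] [Module R P] [AddCommGroup M] [Module R M]

/-- A quadratic form is non-degenerate when `d : z ↦ ⟨z, ·⟩` is an isomorphism `Q ≅ Q^*`. -/
def IsNondegenerate (q : QuadraticForm R Q) : Prop :=
  Function.Bijective (q.polarBilin : Q →ₗ[R] Module.Dual R Q)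

/-- The isomorphism `d : Q ≅ Q^*`, `d(z)(w) = ⟨z, w⟩`. -/
noncomputable def dIso (q : QuadraticForm R Q) (hq : IsNondegenerate q) :
    Q ≃ₗ[R] Module.Dual R Q :=
  LinearEquiv.ofBijective (q.polarBilin : Q →ₗ[R] Module.Dual R Q) hq

/-- `Q ⊥ H(P)`: the orthogonal sum of `(Q, q)` with the hyperbolic space `H(P)`, whose quadratic
form on `P^* × P` is `(f, x) ↦ f x`, with polar form `f₂ x₁ + f₁ x₂`. -/
def sumHyp (P : Type*) [AddCommGroup P] [Module R P] (q : QuadraticForm R Q) :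
    QuadraticForm R (Q × (Module.Dual R P × P)) :=
  QuadraticMap.prod q (QuadraticForm.dualProd R P)

/-- `α^* = d⁻¹ ∘ α^t : P^* → Q` for `α : Q → P`. -/
noncomputable def starAlpha (q : QuadraticForm R Q) (hq : IsNondegenerate q) (α : Q →ₗ[R] P) :
    Module.Dual R P →ₗ[R] Q :=
  (dIso q hq).symm.toLinearMap ∘ₗ α.dualMap

/-- `β^* = d⁻¹ ∘ β^t ∘ i : P → Q` for `β : Q → P^*`, with `i : P → P^{**}` the natural map. -/
noncomputable def starBeta (q : QuadraticForm R Q) (hq : IsNondegenerate q)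
    (β : Q →ₗ[R] Module.Dual R P) : P →ₗ[R] Q :=
  (dIso q hq).symm.toLinearMap ∘ₗ β.dualMap ∘ₗ Module.Dual.eval R P

/-- `E_α (z, x, f) = (z - α^* f, x + α z - (1/2) α (α^* f), f)`;
a vector of `Q ⊥ H(P)` is written `(z, (f, x))` here. -/
noncomputable def dserAlpha [Invertible (2 : R)] (q : QuadraticForm R Q) (hq : IsNondegenerate q)
    (α : Q →ₗ[R] P) (y : Q × (Module.Dual R P × P)) : Q × (Module.Dual R P × P) :=
  (y.1 - starAlpha q hq α y.2.1,
    (y.2.1, y.2.2 + α y.1 - ⅟(2 : R) • α (starAlpha q hq α y.2.1)))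

/-- `E^*_β (z, x, f) = (z - β^* x, x, f + β z - (1/2) β (β^* x))`;
a vector of `Q ⊥ H(P)` is written `(z, (f, x))` here. -/
noncomputable def dserBeta [Invertible (2 : R)] (q : QuadraticForm R Q) (hq : IsNondegenerate q)
    (β : Q →ₗ[R] Module.Dual R P) (y : Q × (Module.Dual R P × P)) :
    Q × (Module.Dual R P × P) :=
  (y.1 - starBeta q hq β y.2.2,
    (y.2.1 + β y.1 - ⅟(2 : R) • β (starBeta q hq β y.2.2), y.2.2))

/-- Let `(M, q')` be identified with `Q ⊥ H(P)` by the isometry `e`. This is the group of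
automorphisms of `M` generated by the DSER transformations `E_α`, `E^*_β` of `M = Q ⊥ H(P)` with
`α : Q → J P` and `β : Q → J P^*`. -/
def dserTrue [Invertible (2 : R)] (q : QuadraticForm R Q) (hq : IsNondegenerate q)
    {q' : QuadraticForm R M} (e : QuadraticMap.IsometryEquiv (sumHyp P q) q') (J : Ideal R) :
    Subgroup (M ≃ₗ[R] M) :=
  Subgroup.closure
    ({g | ∃ α : Q →ₗ[R] P, (∀ z, α z ∈ J • (⊤ : Submodule R P)) ∧
        ∀ y, g (e y) = e (dserAlpha q hq α y)} ∪
     {g | ∃ β : Q →ₗ[R] Module.Dual R P, (∀ z, β z ∈ J • (⊤ : Submodule R (Module.Dual R P))) ∧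
        ∀ y, g (e y) = e (dserBeta q hq β y)})

/-- The DSER elementary orthogonal group `EO_R(Q, H(P))`, acting on `M = Q ⊥ H(P)`. -/
def dser [Invertible (2 : R)] (q : QuadraticForm R Q) (hq : IsNondegenerate q)
    {q' : QuadraticForm R M} (e : QuadraticMap.IsometryEquiv (sumHyp P q) q') :
    Subgroup (M ≃ₗ[R] M) :=
  dserTrue q hq e ⊤

/-- The relative DSER elementary orthogonal group `EO_{(R,I)}(Q, H(P))`: the normal closure in
`EO_R(Q, H(P))` of the true relative group `EO_I(Q, H(P))`. -/
def dserRel [Invertible (2 : R)] (q : QuadraticForm R Q) (hq : IsNondegenerate q)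
    {q' : QuadraticForm R M} (e : QuadraticMap.IsometryEquiv (sumHyp P q) q') (I : Ideal R) :
    Subgroup (M ≃ₗ[R] M) :=
  normalClosureIn (dserTrue q hq e I) (dser q hq e)

end DSER

/-- The quadratic module `(M, q)` has hyperbolic rank at least `m`: it contains an isometric copy
of `H(R)^m = H(R^m)` (which is then an orthogonal summand, as `H(R^m)` is non-degenerate). -/
def HyperbolicRankGE {R M : Type*} [CommRing R] [AddCommGroup M] [Module R M]
    (q : QuadraticForm R M) (m : ℕ) : Prop :=
  Nonempty (QuadraticMap.Isometry (QuadraticForm.dualProd R (Fin m → R)) q)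

/-- For the maximal ideal `𝔪` the localized bilinear form `⟨,⟩_𝔪` of `(M, q)` has the matrix `φ`
(a matrix over `R`, read over `R_𝔪`) with respect to some basis of `M_𝔪`. -/
def LocallyHasMatrix {R M : Type*} [CommRing R] [AddCommGroup M] [Module R M]
    (q : QuadraticForm R M) {N : ℕ} (φ : Matrix (Fin N) (Fin N) R)
    (𝔪 : Ideal R) [𝔪.IsMaximal] : Prop :=
  ∃ b : Module.Basis (Fin N) (Localization.AtPrime 𝔪) (Localization.AtPrime 𝔪 ⊗[R] M),
    LinearMap.BilinForm.toMatrix b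
        (LinearMap.BilinForm.baseChange (Localization.AtPrime 𝔪) q.polarBilin) =
      φ.map (algebraMap R (Localization.AtPrime 𝔪))

end QuadSpace

/-!
The equality holds without any local-global principle for polynomial rings; the only localisation
is that of ideals of coefficients. Write `σ_{u,v}` for `esd q u v`. For isotropic `u`, the set of
`v ⟂ u` such that a group contains `σ_{u, r v}` for all `r ∈ I` is a submodule (`esdArg`), so
membership in it may be tested at each maximal ideal `𝔪`, up to a denominator outside `𝔪`
(`mem_of_forall_maximal`).

Suppose that `M = Q₀ ⊥ (P₁ ⊕ P₂)` as in `HypSplitting`, that a group `G` of isometries contains the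
`σ_{a,k}` with `a ∈ P₁ ∪ P₂` and `k ∈ Q₀`, and that a group `N` normalised by `G` contains those with
`k ∈ I Q₀`. The values of the form on `Q₀` generate the unit ideal, so commutators show that `N`
contains `σ_{c,w}` for orthogonal roots `c`, `w` with `w` scaled by `I` (`IsRoot.mem_esdArg`). Let
`u` be isotropic with `α = ⟨u, e_i⟩ ∉ 𝔪`. Vectors orthogonal to `u` are, up to `α`, the contractions
`⟨u, e_i⟩ b - ⟨u, b⟩ e_i`. For `b` in `P₁` or among the `ε_j`, `j ≠ i`, these are roots, and
`σ_{u,c} = σ_{c,-u}` is a product of known transvections. For `b ∈ Q₀`, a transvection that fixes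
`u` moves one such root by a multiple of the contraction, up to another root; this uses `m ≥ 2`
(`HypSplitting.smul_mem_esdArg_of_mem`). Finally `u` itself, for which `σ_{u,u} = 1`, accounts for
`b = ε_i`. If only `⟨u, Q₀⟩` is not contained in `𝔪`, conjugation by some `σ_{e_i,k}` reduces to
this case. So every `v ⟂ u` is an admissible argument up to a denominator outside `𝔪`
(`HypSplitting.exists_smul_mem_esdArg`).

Applied to `M = Q ⊥ H(P)`, this shows that the DSER group contains the transvections. Applied to
`M = Q' ⊥ H(R)^m`, where `Q'` has positive rank `n` and the hyperbolic pairs are unimodular, it shows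
that `TransO` contains `σ_{p,v}` for `p ∈ P`, because `p` is locally a combination of isotropic vectors
that are nonzero modulo `𝔪` (`LocallyHasEsd.hasEsd_of_isotropic`); each `E_α` is a product of these
(`exists_mem_unipotent`). Both inclusions hold relative to any ideal. For the unit ideal they
identify the two ambient groups, and then the two normal closures coincide.
-/

namespace QuadSpace

/-! ### Eichler-Siegel-Dickson transvections -/

section Esd
variable {R M : Type*} [CommRing R] [AddCommGroup M] [Module R M]

lemma polarBilin_comm (q : QuadraticForm R M) (x y : M) :
    q.polarBilin x y = q.polarBilin y x := by
  simp [QuadraticMap.polar_comm]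

lemma polarBilin_self (q : QuadraticForm R M) (x : M) : q.polarBilin x x = 2 * q x := by
  simp [QuadraticMap.polar_self]

lemma map_add_polarBilin (q : QuadraticForm R M) (x y : M) :
    q (x + y) = q x + q y + q.polarBilin x y := by
  simp [QuadraticMap.polar]

lemma map_smul_sq (q : QuadraticForm R M) (r : R) (x : M) : q (r • x) = r * r * q x := by
  simp [QuadraticMap.map_smul]

/-- `esd q u v` preserves `q` as soon as `u` is isotropic and orthogonal to `v`. -/
lemma map_esd (q : QuadraticForm R M) {u v : M} (hu : q u = 0) (huv : q.polarBilin u v = 0)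
    (x : M) : q (esd q u v x) = q x := by
  have hvu : q.polarBilin v u = 0 := by rw [polarBilin_comm, huv]
  have h1 := polarBilin_comm q x u
  have h2 := polarBilin_comm q x v
  have h3 := polarBilin_self q u
  simp only [esd, sub_eq_add_neg, ← neg_smul, map_add_polarBilin, map_add, map_smul,
    LinearMap.add_apply, LinearMap.smul_apply, smul_eq_mul, map_smul_sq, hu, huv, hvu, h1, h2, h3]
  ring

lemma esd_add_right (q : QuadraticForm R M) {u v w : M} (hu : q u = 0)
    (huv : q.polarBilin u v = 0) (huw : q.polarBilin u w = 0) (x : M) :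
    esd q u v (esd q u w x) = esd q u (v + w) x := by
  have hvu : q.polarBilin v u = 0 := by rw [polarBilin_comm, huv]
  have h3 : q.polarBilin u u = 0 := by rw [polarBilin_self, hu, mul_zero]
  simp only [esd, sub_eq_add_neg, ← neg_smul, map_add_polarBilin q v w, map_add, map_smul,
    LinearMap.add_apply, smul_eq_mul, huw, hvu, h3]
  module

lemma esd_zero_right (q : QuadraticForm R M) (u x : M) : esd q u 0 x = x := by simp [esd]

lemma esd_smul_left (q : QuadraticForm R M) (r : R) (u v x : M) :
    esd q (r • u) v x = esd q u (r • v) x := by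
  simp only [esd, map_smul_sq, map_smul, LinearMap.smul_apply, smul_eq_mul]
  module

/-- Two orthogonal isotropic vectors may exchange their roles. -/
lemma esd_swap (q : QuadraticForm R M) {u v : M} (hu : q u = 0) (hv : q v = 0) (x : M) :
    esd q u v x = esd q v (-u) x := by
  simp only [esd, QuadraticMap.map_neg, hu, hv, map_neg, LinearMap.neg_apply]
  module

/-- Additivity in the isotropic argument holds up to a transvection along the isotropic plane. -/
lemma esd_add_left (q : QuadraticForm R M) {a b v : M} (ha : q a = 0) (hb : q b = 0)
    (hab : q.polarBilin a b = 0) (hav : q.polarBilin a v = 0) (hbv : q.polarBilin b v = 0)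
    (x : M) :
    esd q (a + b) v x = esd q a (q v • b) (esd q a v (esd q b v x)) := by
  have hba : q.polarBilin b a = 0 := by rw [polarBilin_comm, hab]
  have hvb : q.polarBilin v b = 0 := by rw [polarBilin_comm, hbv]
  have h3 : q.polarBilin a a = 0 := by rw [polarBilin_self, ha, mul_zero]
  have h4 : q.polarBilin b b = 0 := by rw [polarBilin_self, hb, mul_zero]
  have h5 := polarBilin_self q v
  simp only [esd, sub_eq_add_neg, ← neg_smul, map_add, map_smul, map_smul_sq, hb,
    LinearMap.add_apply, LinearMap.smul_apply, smul_eq_mul, hab, hav, hbv, hba, hvb, h3, h4,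
    h5]
  module

/-- `esd q u v` as an automorphism, with inverse `esd q u (-v)`. -/
def esdEquiv (q : QuadraticForm R M) (u v : M) (hu : q u = 0) (huv : q.polarBilin u v = 0) :
    M ≃ₗ[R] M where
  toFun := esd q u v
  invFun := esd q u (-v)
  map_add' x y := by
    simp only [esd, map_add]
    module
  map_smul' r x := by
    simp only [esd, map_smul, smul_eq_mul, RingHom.id_apply]
    module
  left_inv x := by
    rw [esd_add_right q hu (by simpa using huv) huv, neg_add_cancel, esd_zero_right]
  right_inv x := by
    rw [esd_add_right q hu huv (by simpa using huv), add_neg_cancel, esd_zero_right]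

/-- The group `N` contains the transvection `σ_{u,v}`. -/
def HasEsd (q : QuadraticForm R M) (N : Subgroup (M ≃ₗ[R] M)) (u v : M) : Prop :=
  ∃ g ∈ N, ∀ x, g x = esd q u v x

variable {q : QuadraticForm R M} {N : Subgroup (M ≃ₗ[R] M)}

lemma HasEsd.mem {u v : M} (h : HasEsd q N u v) {g : M ≃ₗ[R] M} (hg : ∀ x, g x = esd q u v x) :
    g ∈ N := by
  obtain ⟨g', hg', h'⟩ := h
  have : g = g' := LinearEquiv.ext fun x => by rw [hg, h']
  rwa [this]

lemma HasEsd.mono {N' : Subgroup (M ≃ₗ[R] M)} (hN : N ≤ N') {u v : M} (h : HasEsd q N u v) :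
    HasEsd q N' u v :=
  let ⟨g, hg, h'⟩ := h
  ⟨g, hN hg, h'⟩

lemma hasEsd_zero (u : M) : HasEsd q N u 0 := ⟨1, N.one_mem, fun x => by simp [esd_zero_right]⟩

lemma HasEsd.add {u v w : M} (hv : HasEsd q N u v) (hw : HasEsd q N u w) (hu : q u = 0)
    (huv : q.polarBilin u v = 0) (huw : q.polarBilin u w = 0) : HasEsd q N u (v + w) := by
  obtain ⟨g, hg, h⟩ := hv
  obtain ⟨g', hg', h'⟩ := hw
  exact ⟨g * g', N.mul_mem hg hg', fun x => by
    rw [LinearEquiv.mul_apply, h, h', esd_add_right q hu huv huw]⟩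

lemma HasEsd.neg {u v : M} (hv : HasEsd q N u v) (hu : q u = 0)
    (huv : q.polarBilin u v = 0) : HasEsd q N u (-v) := by
  obtain ⟨g, hg, h⟩ := hv
  refine ⟨g⁻¹, N.inv_mem hg, fun x => ?_⟩
  apply g.injective
  rw [h (esd q u (-v) x), esd_add_right q hu huv (by simpa using huv), add_neg_cancel,
    esd_zero_right, ← LinearEquiv.mul_apply, mul_inv_cancel, LinearEquiv.coe_one, id]

lemma HasEsd.of_neg {u v : M} (hv : HasEsd q N u (-v)) (hu : q u = 0)
    (huv : q.polarBilin u v = 0) : HasEsd q N u v := by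
  have := hv.neg hu (by simpa using huv)
  rwa [neg_neg] at this

lemma hasEsd_smul_left {u v : M} (r : R) : HasEsd q N (r • u) v ↔ HasEsd q N u (r • v) := by
  simp only [HasEsd, esd_smul_left]

lemma HasEsd.swap {u v : M} (h : HasEsd q N u v) (hu : q u = 0) (hv : q v = 0)
    (huv : q.polarBilin u v = 0) : HasEsd q N v u := by
  have h' : HasEsd q N v (-u) := by
    obtain ⟨g, hg, h⟩ := h
    exact ⟨g, hg, fun x => by rw [h, esd_swap q hu hv]⟩
  exact h'.of_neg hv (by rw [polarBilin_comm, huv])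

lemma HasEsd.add_left {a b v : M} (h1 : HasEsd q N a v) (h2 : HasEsd q N b v)
    (h3 : HasEsd q N a (q v • b)) (ha : q a = 0) (hb : q b = 0)
    (hab : q.polarBilin a b = 0) (hav : q.polarBilin a v = 0) (hbv : q.polarBilin b v = 0) :
    HasEsd q N (a + b) v := by
  obtain ⟨g3, hg3, e3⟩ := h3
  obtain ⟨g1, hg1, e1⟩ := h1
  obtain ⟨g2, hg2, e2⟩ := h2
  refine ⟨g3 * g1 * g2, N.mul_mem (N.mul_mem hg3 hg1) hg2, fun x => ?_⟩
  rw [LinearEquiv.mul_apply, LinearEquiv.mul_apply, e3, e1, e2,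
    esd_add_left q ha hb hab hav hbv]

lemma polarBilin_map {g : M ≃ₗ[R] M} (hg : ∀ x, q (g x) = q x) (x y : M) :
    q.polarBilin (g x) (g y) = q.polarBilin x y := by
  simp [QuadraticMap.polar, ← map_add, hg]

/-- Conjugation by an isometry `g` carries `σ_{u,v}` to `σ_{g u, g v}`. -/
lemma HasEsd.conj {u v : M} (h : HasEsd q N u v) {g : M ≃ₗ[R] M} (hg : ∀ x, q (g x) = q x)
    (hN : ∀ n ∈ N, g * n * g⁻¹ ∈ N) : HasEsd q N (g u) (g v) := by
  obtain ⟨n, hn, h⟩ := h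
  refine ⟨_, hN n hn, fun x => ?_⟩
  obtain ⟨y, rfl⟩ := g.surjective x
  have : g⁻¹ (g y) = y := by
    rw [← LinearEquiv.mul_apply, inv_mul_cancel, LinearEquiv.coe_one, id]
  rw [LinearEquiv.mul_apply, LinearEquiv.mul_apply, this, h]
  simp only [esd, polarBilin_map hg, hg, map_add, map_sub, map_smul]

end Esd

/-! ### Admissible arguments and roots -/

section Splitting
variable {R M : Type*} [CommRing R] [AddCommGroup M] [Module R M]

/-- Membership in a submodule can be checked at the maximal ideals, up to a denominator. -/
lemma mem_of_forall_maximal (S : Submodule R M) (c : M)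
    (h : ∀ 𝔪 : Ideal R, 𝔪.IsMaximal → ∃ t ∉ 𝔪, t • c ∈ S) : c ∈ S := by
  have h1 : S.comap (LinearMap.toSpanSingleton R M c) = (⊤ : Ideal R) := by
    by_contra hne
    obtain ⟨𝔪, h𝔪, hle⟩ := Ideal.exists_le_maximal _ hne
    obtain ⟨t, ht, htc⟩ := h 𝔪 h𝔪
    exact ht (hle htc)
  have h2 : (1 : R) ∈ S.comap (LinearMap.toSpanSingleton R M c) := h1 ▸ Submodule.mem_top
  simpa using h2

/-- For an isotropic vector `u`: the vectors `c ⟂ u` such that `N` contains `σ_{u, r c}` for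
all `r ∈ I`. -/
def esdArg (q : QuadraticForm R M) (N : Subgroup (M ≃ₗ[R] M)) (I : Ideal R) (u : M)
    (hu : q u = 0) : Submodule R M where
  carrier := {c | q.polarBilin u c = 0 ∧ ∀ r ∈ I, HasEsd q N u (r • c)}
  add_mem' := by
    rintro a b ⟨ha, ha'⟩ ⟨hb, hb'⟩
    refine ⟨by rw [map_add, ha, hb, add_zero], fun r hr => ?_⟩
    rw [smul_add]
    exact (ha' r hr).add (hb' r hr) hu (by rw [map_smul, ha, smul_zero])
      (by rw [map_smul, hb, smul_zero])
  zero_mem' := ⟨map_zero _, fun r _ => by rw [smul_zero]; exact hasEsd_zero u⟩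
  smul_mem' := by
    rintro t a ⟨ha, ha'⟩
    refine ⟨by rw [map_smul, ha, smul_zero], fun r hr => ?_⟩
    rw [smul_smul]
    exact ha' _ (I.mul_mem_right t hr)

variable {q : QuadraticForm R M} {G N : Subgroup (M ≃ₗ[R] M)} {I : Ideal R}

lemma smul_mem_esdArg_comm {u c : M} (hu : q u = 0) (hc : q c = 0) {s : R}
    (huc : q.polarBilin u c = 0) (h : s • u ∈ esdArg q N I c hc) :
    s • c ∈ esdArg q N I u hu := by
  refine ⟨by rw [map_smul, huc, smul_zero], fun r hr => ?_⟩
  have h1 := h.2 r hr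
  rw [smul_smul] at h1 ⊢
  rw [← hasEsd_smul_left]
  exact h1.swap hc (by rw [map_smul_sq, hu, mul_zero])
    (by rw [map_smul, polarBilin_comm, huc, smul_zero])

lemma mem_esdArg_comm {u c : M} (hu : q u = 0) (hc : q c = 0)
    (huc : q.polarBilin u c = 0) (h : u ∈ esdArg q N I c hc) : c ∈ esdArg q N I u hu := by
  rw [← one_smul R u] at h
  simpa using smul_mem_esdArg_comm hu hc huc h

lemma self_mem_esdArg {u : M} (hu : q u = 0) : u ∈ esdArg q N I u hu := by
  refine ⟨by rw [polarBilin_self, hu, mul_zero], fun r _ => ?_⟩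
  refine ⟨1, N.one_mem, fun x => ?_⟩
  simp only [LinearEquiv.coe_one, id, esd, map_smul, LinearMap.smul_apply, map_smul_sq, hu,
    smul_eq_mul]
  module

/-- `G` acts by isometries and normalises `N`. -/
structure IsometricAction (q : QuadraticForm R M) (G N : Subgroup (M ≃ₗ[R] M)) : Prop where
  map_apply : ∀ g ∈ G, ∀ x, q (g x) = q x
  conj_mem : ∀ g ∈ G, ∀ n ∈ N, g * n * g⁻¹ ∈ N

lemma IsometricAction.self (h : IsometricAction q G N) : IsometricAction q G G :=
  ⟨h.map_apply, fun _ hg _ hn => G.mul_mem (G.mul_mem hg hn) (G.inv_mem hg)⟩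

lemma IsometricAction.mem_esdArg (h : IsometricAction q G N) {u v c : M} (hu : q u = 0)
    (hv : q v = 0) {g : M ≃ₗ[R] M} (hg : g ∈ G) (huv : g u = v) (hc : c ∈ esdArg q N I u hu) :
    g c ∈ esdArg q N I v hv := by
  subst huv
  refine ⟨by rw [polarBilin_map (h.map_apply g hg), hc.1], fun r hr => ?_⟩
  rw [← map_smul]
  exact (hc.2 r hr).conj (h.map_apply g hg) (h.conj_mem g hg)

/-- `c` is an isotropic vector orthogonal to `Q₀` such that `N` contains all `σ_{c, r k}` with
`k ∈ Q₀` and `r ∈ I`. -/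
structure IsRoot (q : QuadraticForm R M) (Q₀ : Submodule R M) (N : Subgroup (M ≃ₗ[R] M))
    (I : Ideal R) (c : M) : Prop where
  isotropic : q c = 0
  orth : ∀ k ∈ Q₀, q.polarBilin c k = 0
  hasEsd : ∀ k ∈ Q₀, ∀ r ∈ I, HasEsd q N c (r • k)

/-- The values of the form on `Q₀` generate the unit ideal. -/
def HasUnitTrace (q : QuadraticForm R M) (Q₀ : Submodule R M) : Prop :=
  ∀ 𝔪 : Ideal R, 𝔪.IsMaximal → ∃ k ∈ Q₀, ∃ k' ∈ Q₀, q.polarBilin k k' ∉ 𝔪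

variable {Q₀ : Submodule R M}

lemma IsRoot.mem_esdArg_of_mem {c k : M} (hc : IsRoot q Q₀ N I c) (hk : k ∈ Q₀) :
    k ∈ esdArg q N I c hc.isotropic :=
  ⟨hc.orth k hk, hc.hasEsd k hk⟩

/-- The commutator of `σ_{c,k}` and `σ_{w,k'}` is `σ_{c, ⟨k,k'⟩ w}`, up to sign; as the scalars
`⟨k,k'⟩` generate the unit ideal, they can be removed. -/
lemma IsRoot.mem_esdArg (h : IsometricAction q G N) (hQ : HasUnitTrace q Q₀) {c w : M}
    (hc : IsRoot q Q₀ G ⊤ c) (hw : IsRoot q Q₀ N I w) (hcw : q.polarBilin c w = 0) :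
    w ∈ esdArg q N I c hc.isotropic := by
  refine mem_of_forall_maximal _ _ fun 𝔪 h𝔪 => ?_
  obtain ⟨k, hk, k', hk', hkk⟩ := hQ 𝔪 h𝔪
  refine ⟨_, hkk, by rw [map_smul, hcw, smul_zero], fun r hr => ?_⟩
  obtain ⟨g, hg, hgx⟩ := hc.hasEsd k hk 1 trivial
  rw [one_smul] at hgx
  have hwc : q.polarBilin w c = 0 := by rw [polarBilin_comm, hcw]
  have hgw : g w = w := by
    rw [hgx, esd, hcw, polarBilin_comm, hw.orth k hk]
    simp
  have hgk : g (r • k') = r • k' + (r * q.polarBilin k k') • c := by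
    rw [hgx, esd, map_smul, map_smul, hc.orth k' hk']
    simp [-QuadraticMap.polarBilin_apply_apply]
  have h1 := (hw.hasEsd k' hk' r hr).conj (h.map_apply g hg) (h.conj_mem g hg)
  rw [hgw, hgk] at h1
  have h2 := ((hw.hasEsd k' hk' r hr).neg hw.isotropic
    (by rw [map_smul, hw.orth k' hk', smul_zero])).add h1 hw.isotropic
    (by rw [map_neg, map_smul, hw.orth k' hk', smul_zero, neg_zero])
    (by rw [map_add, map_smul, map_smul, hw.orth k' hk', hwc, smul_zero, smul_zero, add_zero])
  rw [neg_add_cancel_left] at h2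
  rw [smul_smul, ← hasEsd_smul_left]
  exact h2.swap hw.isotropic (by rw [map_smul_sq, hc.isotropic, mul_zero])
    (by rw [map_smul, hwc, smul_zero])

/-- Roots for both `N` (relative to `I`) and `G`. -/
def IsRootPair (q : QuadraticForm R M) (Q₀ : Submodule R M) (G N : Subgroup (M ≃ₗ[R] M))
    (I : Ideal R) (c : M) : Prop :=
  IsRoot q Q₀ N I c ∧ IsRoot q Q₀ G ⊤ c

lemma IsRoot.smul {c : M} (hc : IsRoot q Q₀ N I c) (t : R) : IsRoot q Q₀ N I (t • c) where
  isotropic := by rw [map_smul_sq, hc.isotropic, mul_zero]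
  orth k hk := by rw [map_smul, LinearMap.smul_apply, hc.orth k hk, smul_zero]
  hasEsd k hk r hr := by
    rw [hasEsd_smul_left, smul_smul]
    exact hc.hasEsd k hk _ (I.mul_mem_left t hr)

lemma IsRoot.add (h : IsometricAction q G N) (hQ : HasUnitTrace q Q₀) {a b : M}
    (ha : IsRoot q Q₀ N I a) (ha' : IsRoot q Q₀ G ⊤ a) (hb : IsRoot q Q₀ N I b)
    (hab : q.polarBilin a b = 0) : IsRoot q Q₀ N I (a + b) where
  isotropic := by rw [map_add_polarBilin, ha.isotropic, hb.isotropic, hab, add_zero, add_zero]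
  orth k hk := by rw [map_add, LinearMap.add_apply, ha.orth k hk, hb.orth k hk, add_zero]
  hasEsd k hk r hr := by
    refine (ha.hasEsd k hk r hr).add_left (hb.hasEsd k hk r hr) ?_ ha.isotropic hb.isotropic hab
      (by rw [map_smul, ha.orth k hk, smul_zero]) (by rw [map_smul, hb.orth k hk, smul_zero])
    rw [map_smul_sq, mul_assoc]
    exact (ha'.mem_esdArg h hQ hb hab).2 _ (I.mul_mem_right _ hr)

lemma IsRootPair.smul {c : M} (hc : IsRootPair q Q₀ G N I c) (t : R) :
    IsRootPair q Q₀ G N I (t • c) :=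
  ⟨hc.1.smul t, hc.2.smul t⟩

lemma IsRootPair.add (h : IsometricAction q G N) (hQ : HasUnitTrace q Q₀) {a b : M}
    (ha : IsRootPair q Q₀ G N I a) (hb : IsRootPair q Q₀ G N I b)
    (hab : q.polarBilin a b = 0) : IsRootPair q Q₀ G N I (a + b) :=
  ⟨ha.1.add h hQ ha.2 hb.1 hab, ha.2.add h.self hQ ha.2 hb.2 hab⟩

lemma IsRootPair.mem_esdArg (h : IsometricAction q G N) (hQ : HasUnitTrace q Q₀) {c w : M}
    (hc : IsRootPair q Q₀ G N I c) (hw : IsRootPair q Q₀ G N I w)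
    (hcw : q.polarBilin c w = 0) : w ∈ esdArg q N I c hc.1.isotropic :=
  hc.2.mem_esdArg h hQ hw.1 hcw

/-- Families `e` in `P₁` and `ε` in `P₂` which are dual bases of `P₁` and `P₂` up to the
denominator `s`. -/
structure IsDualBasis (q : QuadraticForm R M) (P₁ P₂ : Submodule R M) {m : ℕ} (s : R)
    (e ε : Fin m → M) : Prop where
  left_mem : ∀ i, e i ∈ P₁
  right_mem : ∀ i, ε i ∈ P₂
  pairing : ∀ i j, q.polarBilin (e i) (ε j) = if i = j then s else 0
  left_sum : ∀ x ∈ P₁, s • x = ∑ i, q.polarBilin x (ε i) • e i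
  right_sum : ∀ x ∈ P₂, s • x = ∑ i, q.polarBilin x (e i) • ε i

lemma IsDualBasis.symm {P₁ P₂ : Submodule R M} {m : ℕ} {s : R} {e ε : Fin m → M}
    (h : IsDualBasis q P₁ P₂ s e ε) : IsDualBasis q P₂ P₁ s ε e where
  left_mem := h.right_mem
  right_mem := h.left_mem
  pairing i j := by
    rw [polarBilin_comm, h.pairing]
    simp only [eq_comm]
  left_sum := h.right_sum
  right_sum := h.left_sum

/-- `M = Q₀ ⊥ (P₁ ⊕ P₂)` with `P₁`, `P₂` totally isotropic and locally free of rank `m`, in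
duality with each other up to denominators; the values of the form on `Q₀` generate the unit
ideal. -/
structure HypSplitting (q : QuadraticForm R M) (Q₀ P₁ P₂ : Submodule R M) (m : ℕ) : Prop where
  isotropic_left : ∀ a ∈ P₁, q a = 0
  isotropic_right : ∀ a ∈ P₂, q a = 0
  orth_left : ∀ a ∈ P₁, ∀ k ∈ Q₀, q.polarBilin a k = 0
  orth_right : ∀ a ∈ P₂, ∀ k ∈ Q₀, q.polarBilin a k = 0
  exists_add : ∀ x, ∃ k ∈ Q₀, ∃ a ∈ P₁, ∃ b ∈ P₂, x = k + a + b
  unitTrace : HasUnitTrace q Q₀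
  exists_dualBasis : ∀ 𝔪 : Ideal R, 𝔪.IsMaximal → ∃ s ∉ 𝔪, ∃ e ε : Fin m → M,
    IsDualBasis q P₁ P₂ s e ε

variable {P₁ P₂ : Submodule R M} {m : ℕ}

lemma HypSplitting.symm (h : HypSplitting q Q₀ P₁ P₂ m) : HypSplitting q Q₀ P₂ P₁ m where
  isotropic_left := h.isotropic_right
  isotropic_right := h.isotropic_left
  orth_left := h.orth_right
  orth_right := h.orth_left
  exists_add x := by
    obtain ⟨k, hk, a, ha, b, hb, rfl⟩ := h.exists_add x
    exact ⟨k, hk, b, hb, a, ha, by abel⟩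
  unitTrace := h.unitTrace
  exists_dualBasis 𝔪 h𝔪 := by
    obtain ⟨s, hs, e, ε, he⟩ := h.exists_dualBasis 𝔪 h𝔪
    exact ⟨s, hs, ε, e, he.symm⟩

lemma HypSplitting.polarBilin_left (h : HypSplitting q Q₀ P₁ P₂ m) {a b : M} (ha : a ∈ P₁)
    (hb : b ∈ P₁) : q.polarBilin a b = 0 := by
  have := map_add_polarBilin q a b
  rw [h.isotropic_left _ (P₁.add_mem ha hb), h.isotropic_left _ ha, h.isotropic_left _ hb] at this
  simpa using this.symm

end Splitting

/-! ### Transvections along isotropic vectors that are nonzero modulo a maximal ideal -/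

section Splitting
variable {R M : Type*} [CommRing R] [AddCommGroup M] [Module R M]
  {q : QuadraticForm R M} {G N : Subgroup (M ≃ₗ[R] M)} {I : Ideal R}
  {Q₀ P₁ P₂ : Submodule R M} {m : ℕ}

/-- A vector of `P₁` orthogonal to the isotropic vector `u` is an admissible argument of
`σ_{u,·}`: the roles can be exchanged, and `u` splits into its components. -/
lemma HypSplitting.mem_esdArg_left (h : HypSplitting q Q₀ P₁ P₂ m) (hG : IsometricAction q G N)
    (h₁ : ∀ a ∈ P₁, IsRootPair q Q₀ G N I a) (h₂ : ∀ a ∈ P₂, IsRootPair q Q₀ G N I a)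
    {u c : M} (hu : q u = 0) (hc : c ∈ P₁) (huc : q.polarBilin u c = 0) :
    c ∈ esdArg q N I u hu := by
  refine mem_esdArg_comm hu (h₁ c hc).1.isotropic huc ?_
  obtain ⟨k, hk, a, ha, b, hb, rfl⟩ := h.exists_add u
  have hcb : q.polarBilin c b = 0 := by
    rw [polarBilin_comm] at huc
    simpa only [map_add, h.orth_left c hc k hk, h.polarBilin_left hc ha, zero_add] using huc
  exact add_mem (add_mem ((h₁ c hc).1.mem_esdArg_of_mem hk)
    ((h₁ c hc).mem_esdArg hG h.unitTrace (h₁ a ha) (h.polarBilin_left hc ha)))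
    ((h₁ c hc).mem_esdArg hG h.unitTrace (h₂ b hb) hcb)

lemma HypSplitting.dual_sum (h : HypSplitting q Q₀ P₁ P₂ m) {s : R} {e ε : Fin m → M}
    (hb : IsDualBasis q P₁ P₂ s e ε) (u : M) : ∃ k ∈ Q₀,
      s • u = k + ∑ i, q.polarBilin u (ε i) • e i + ∑ i, q.polarBilin u (e i) • ε i := by
  obtain ⟨k, hk, a, ha, b, hb', rfl⟩ := h.exists_add u
  refine ⟨s • k, Q₀.smul_mem s hk, ?_⟩
  rw [smul_add, smul_add, hb.left_sum a ha, hb.right_sum b hb']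
  refine congrArg₂ (· + ·) (congrArg _ (Finset.sum_congr rfl fun i _ => ?_))
    (Finset.sum_congr rfl fun i _ => ?_)
  · have h1 : q.polarBilin k (ε i) = 0 := by
      rw [polarBilin_comm, h.orth_right _ (hb.right_mem i) k hk]
    have h2 : q.polarBilin b (ε i) = 0 := h.symm.polarBilin_left hb' (hb.right_mem i)
    simp only [map_add, LinearMap.add_apply, h1, h2, zero_add, add_zero]
  · have h1 : q.polarBilin k (e i) = 0 := by
      rw [polarBilin_comm, h.orth_left _ (hb.left_mem i) k hk]
    have h2 : q.polarBilin a (e i) = 0 := h.polarBilin_left ha (hb.left_mem i)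
    simp only [map_add, LinearMap.add_apply, h1, h2, zero_add]

/-- The vector `⟨u, e_i⟩ ε_j - ⟨u, ε_j⟩ e_i` with `i ≠ j` is a root orthogonal to `u`, and up to
the denominator `s` it is an admissible argument of `σ_{u,·}`. -/
lemma HypSplitting.smul_mem_esdArg_of_ne (h : HypSplitting q Q₀ P₁ P₂ m)
    (hG : IsometricAction q G N)
    (h₁ : ∀ a ∈ P₁, IsRootPair q Q₀ G N I a) (h₂ : ∀ a ∈ P₂, IsRootPair q Q₀ G N I a)
    {s : R} {e ε : Fin m → M} (hb : IsDualBasis q P₁ P₂ s e ε)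
    {u : M} (hu : q u = 0) {i j : Fin m} (hij : i ≠ j) :
    s • (q.polarBilin u (e i) • ε j - q.polarBilin u (ε j) • e i) ∈ esdArg q N I u hu := by
  have hei := h₁ _ (hb.left_mem i)
  have hεj := h₂ _ (hb.right_mem j)
  have hpair : q.polarBilin (ε j) (e i) = 0 := by
    rw [polarBilin_comm, hb.pairing, if_neg hij]
  set c := q.polarBilin u (e i) • ε j - q.polarBilin u (ε j) • e i with hc_def
  have hc : IsRootPair q Q₀ G N I c := by
    rw [hc_def, sub_eq_add_neg, ← neg_smul]
    refine (hεj.smul _).add hG h.unitTrace (hei.smul _) ?_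
    simp only [map_smul, LinearMap.smul_apply, hpair, smul_zero]
  have huc : q.polarBilin u c = 0 := by
    rw [hc_def, map_sub, map_smul, map_smul, smul_eq_mul, smul_eq_mul, mul_comm, sub_self]
  refine smul_mem_esdArg_comm hu hc.1.isotropic huc ?_
  have hce : ∀ l, q.polarBilin c (e l) = if l = j then q.polarBilin u (e i) * s else 0 := by
    intro l
    rw [hc_def, map_sub, map_smul, map_smul, LinearMap.sub_apply, LinearMap.smul_apply,
      LinearMap.smul_apply, polarBilin_comm q (ε j), hb.pairing,
      h.polarBilin_left (hb.left_mem i) (hb.left_mem l)]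
    split_ifs <;> simp
  have hcε : ∀ l, q.polarBilin c (ε l) = if l = i then -(q.polarBilin u (ε j) * s) else 0 := by
    intro l
    rw [hc_def, map_sub, map_smul, map_smul, LinearMap.sub_apply, LinearMap.smul_apply,
      LinearMap.smul_apply, hb.pairing, h.symm.polarBilin_left (hb.right_mem j) (hb.right_mem l)]
    simp only [eq_comm (a := i)]
    split_ifs <;> simp
  obtain ⟨k, hk, hsum⟩ := h.dual_sum hb u
  -- Only `e_j` and `ε_i` fail to be orthogonal to `c`; their contributions to `s • u` are
  -- grouped into a single root orthogonal to `c`.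
  rw [hsum, ← Finset.add_sum_erase _ _ (Finset.mem_univ j),
    ← Finset.add_sum_erase _ (fun l => q.polarBilin u (e l) • ε l) (Finset.mem_univ i)]
  have hregroup : ∀ a b c d t : M, t + (a + b) + (c + d) = t + (a + c) + b + d := by
    intros; abel
  rw [hregroup]
  refine add_mem (add_mem (add_mem (hc.1.mem_esdArg_of_mem hk) ?_) ?_) ?_
  · refine hc.mem_esdArg hG h.unitTrace (((h₁ _ (hb.left_mem j)).smul _).add hG h.unitTrace
      ((h₂ _ (hb.right_mem i)).smul _) ?_) ?_
    · simp only [map_smul, LinearMap.smul_apply, hb.pairing, if_neg hij.symm, smul_zero]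
    · simp only [map_add, map_smul, hce, hcε, if_pos, smul_eq_mul]
      ring
  · refine sum_mem fun l hl => Submodule.smul_mem _ _
      (hc.mem_esdArg hG h.unitTrace (h₁ _ (hb.left_mem l)) ?_)
    rw [hce, if_neg (Finset.ne_of_mem_erase hl)]
  · refine sum_mem fun l hl => Submodule.smul_mem _ _
      (hc.mem_esdArg hG h.unitTrace (h₂ _ (hb.right_mem l)) ?_)
    rw [hcε, if_neg (Finset.ne_of_mem_erase hl)]

/-- The vector `t = ⟨u, e_i⟩ k - ⟨u, k⟩ e_i` with `k ∈ Q₀` is an admissible argument of `σ_{u,·}`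
up to a denominator. With a second index `j`, the vector `y = ⟨u, e_i⟩ e_j - ⟨u, e_j⟩ e_i` is
orthogonal to `u` and `t`, so `σ_{y,t}` fixes `u`; it moves the admissible vector
`⟨u, e_i⟩ ε_j - ⟨u, ε_j⟩ e_i` by a multiple of `t`, up to a multiple of `y`. -/
lemma HypSplitting.smul_mem_esdArg_of_mem (h : HypSplitting q Q₀ P₁ P₂ m)
    (hG : IsometricAction q G N)
    (h₁ : ∀ a ∈ P₁, IsRootPair q Q₀ G N I a) (h₂ : ∀ a ∈ P₂, IsRootPair q Q₀ G N I a)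
    {s : R} {e ε : Fin m → M} (hb : IsDualBasis q P₁ P₂ s e ε)
    {u : M} (hu : q u = 0) {i j : Fin m} (hij : i ≠ j) {k : M} (hk : k ∈ Q₀) :
    (s ^ 2 * q.polarBilin u (e i) ^ 2) • (q.polarBilin u (e i) • k - q.polarBilin u k • e i) ∈
      esdArg q N I u hu := by
  have hei := h₁ _ (hb.left_mem i)
  set α := q.polarBilin u (e i) with hα
  set t := α • k - q.polarBilin u k • e i with ht_def
  set y := α • e j - q.polarBilin u (e j) • e i with hy_def
  set y' := α • ε j - q.polarBilin u (ε j) • e i with hy'_def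
  have hyP : y ∈ P₁ := P₁.sub_mem (P₁.smul_mem _ (hb.left_mem j)) (P₁.smul_mem _ (hb.left_mem i))
  have hy : IsRootPair q Q₀ G N I y := h₁ y hyP
  have huy : q.polarBilin u y = 0 := by
    rw [hy_def, map_sub, map_smul, map_smul, smul_eq_mul, smul_eq_mul, ← hα, mul_comm, sub_self]
  have hut : q.polarBilin u t = 0 := by
    rw [ht_def, map_sub, map_smul, map_smul, smul_eq_mul, smul_eq_mul, ← hα, mul_comm, sub_self]
  have hyt : q.polarBilin y t = 0 := by
    rw [ht_def, map_sub, map_smul, map_smul, hy.1.orth k hk,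
      h.polarBilin_left hyP (hb.left_mem i), smul_zero, smul_zero, sub_zero]
  have hty' : q.polarBilin t y' = 0 := by
    rw [hy'_def, map_sub, map_smul, map_smul, polarBilin_comm q t, polarBilin_comm q t, ht_def,
      map_sub, map_sub, map_smul, map_smul, map_smul, map_smul, hei.1.orth k hk,
      h.orth_right _ (hb.right_mem j) k hk, polarBilin_comm q (ε j), hb.pairing, if_neg hij,
      h.polarBilin_left (hb.left_mem i) (hb.left_mem i)]
    simp
  have hyy' : q.polarBilin y y' = α * α * s := by
    rw [hy'_def, map_sub, map_smul, map_smul, h.polarBilin_left hyP (hb.left_mem i), hy_def,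
      map_sub, LinearMap.sub_apply, map_smul, map_smul, LinearMap.smul_apply,
      LinearMap.smul_apply, hb.pairing, hb.pairing, if_pos rfl, if_neg hij]
    simp only [smul_eq_mul]
    ring
  have hyS : y ∈ esdArg q N I u hu := h.mem_esdArg_left hG h₁ h₂ hu hyP huy
  have hy'S : s • y' ∈ esdArg q N I u hu := h.smul_mem_esdArg_of_ne hG h₁ h₂ hb hu hij
  obtain ⟨g, hg, hgx⟩ : HasEsd q G y t := by
    have h1 : t ∈ esdArg q G ⊤ y hy.1.isotropic := by
      refine sub_mem (Submodule.smul_mem _ _ (hy.2.mem_esdArg_of_mem hk))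
        (Submodule.smul_mem _ _ ?_)
      exact hy.2.mem_esdArg hG.self h.unitTrace hei.2 (h.polarBilin_left hyP (hb.left_mem i))
    simpa using h1.2 1 trivial
  have hgu : g u = u := by
    rw [hgx, esd, polarBilin_comm q t, polarBilin_comm q y, hut, huy]
    simp
  have hgy' : g (s • y') = s • y' - (s ^ 2 * α ^ 2) • t - (q t * (s * (α * α * s))) • y := by
    rw [hgx, esd, map_smul, map_smul, hty', hyy']
    simp only [smul_eq_mul, mul_zero, zero_smul, add_zero]
    congr 3
    ring
  have h1 := hG.mem_esdArg hu hu hg hgu hy'S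
  rw [hgy'] at h1
  have h2 := sub_mem (sub_mem hy'S h1)
    (Submodule.smul_mem _ (q t * (s * (α * α * s))) hyS)
  convert h2 using 1
  abel

/-- If `⟨u, e_i⟩` is a unit up to denominators, then so is every vector orthogonal to `u` an
admissible argument of `σ_{u,·}`. -/
lemma HypSplitting.smul_mem_esdArg_of_orth (h : HypSplitting q Q₀ P₁ P₂ m) (hm : 2 ≤ m)
    (hG : IsometricAction q G N)
    (h₁ : ∀ a ∈ P₁, IsRootPair q Q₀ G N I a) (h₂ : ∀ a ∈ P₂, IsRootPair q Q₀ G N I a)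
    {s : R} {e ε : Fin m → M} (hb : IsDualBasis q P₁ P₂ s e ε)
    {u : M} (hu : q u = 0) (i : Fin m) {v : M} (huv : q.polarBilin u v = 0) :
    (s ^ 4 * q.polarBilin u (e i) ^ 4) • v ∈ esdArg q N I u hu := by
  have : Nontrivial (Fin m) := Fin.nontrivial_iff_two_le.2 hm
  obtain ⟨j, hj⟩ := exists_ne i
  set S := esdArg q N I u hu
  set α := q.polarBilin u (e i) with hα
  -- the contraction of `e_i ∧ b` with `u`
  let κ : M →ₗ[R] M :=
    α • LinearMap.id - (LinearMap.toSpanSingleton R M (e i)) ∘ₗ (q.polarBilin u)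
  have hκ : ∀ b, κ b = α • b - q.polarBilin u b • e i := fun b => by simp [κ]
  have hQ : ∀ k ∈ Q₀, (s ^ 2 * α ^ 2) • κ k ∈ S := fun k hk => by
    rw [hκ]
    exact h.smul_mem_esdArg_of_mem hG h₁ h₂ hb hu hj.symm hk
  have hP : ∀ a ∈ P₁, κ a ∈ S := fun a ha => by
    refine h.mem_esdArg_left hG h₁ h₂ hu ?_ ?_
    · rw [hκ]
      exact P₁.sub_mem (P₁.smul_mem _ ha) (P₁.smul_mem _ (hb.left_mem i))
    · rw [hκ, map_sub, map_smul, map_smul, smul_eq_mul, smul_eq_mul, ← hα, mul_comm, sub_self]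
  have hne : ∀ l, l ≠ i → s • κ (ε l) ∈ S := fun l hl => by
    rw [hκ]
    exact h.smul_mem_esdArg_of_ne hG h₁ h₂ hb hu hl.symm
  have hsum_left : ∀ w : M, ∑ l, q.polarBilin w (ε l) • e l ∈ P₁ := fun w =>
    sum_mem fun l _ => P₁.smul_mem _ (hb.left_mem l)
  -- `u` itself is admissible; expanding `κ (s • u) = α • s • u` settles the remaining `ε_i`.
  have hi : (s ^ 3 * α ^ 3) • κ (ε i) ∈ S := by
    have hκu : κ (s • u) = (s * α) • u := by
      rw [hκ, map_smul, polarBilin_self, hu]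
      module
    obtain ⟨k, hk, hsum⟩ := h.dual_sum hb u
    have h1 : κ (s • u) ∈ S := hκu ▸ S.smul_mem _ (self_mem_esdArg hu)
    rw [hsum, ← Finset.add_sum_erase _ (fun l => q.polarBilin u (e l) • ε l)
      (Finset.mem_univ i), map_add, map_add, map_add, map_sum κ _ (Finset.univ.erase i),
      map_smul] at h1
    have h2 : s • ∑ l ∈ Finset.univ.erase i, κ (q.polarBilin u (e l) • ε l) ∈ S := by
      rw [Finset.smul_sum]
      refine sum_mem fun l hl => ?_
      rw [map_smul, smul_comm]
      exact S.smul_mem _ (hne l (Finset.ne_of_mem_erase hl))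
    have h3 := S.smul_mem (s ^ 3 * α ^ 2) h1
    have h4 := sub_mem (sub_mem (sub_mem h3 (S.smul_mem s (hQ k hk)))
      (S.smul_mem (s ^ 3 * α ^ 2) (hP _ (hsum_left u)))) (S.smul_mem (s ^ 2 * α ^ 2) h2)
    convert h4 using 1
    rw [← hα]
    module
  obtain ⟨k, hk, hsum⟩ := h.dual_sum hb v
  have hκv : κ v = α • v := by rw [hκ, huv, zero_smul, sub_zero]
  have h1 : (s ^ 4 * α ^ 4) • v = (s ^ 3 * α ^ 3) • κ (s • v) := by
    rw [map_smul, hκv]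
    module
  rw [h1, hsum, map_add, map_add, map_sum κ (fun l => q.polarBilin v (e l) • ε l), smul_add, smul_add, Finset.smul_sum]
  refine add_mem (add_mem ?_ (S.smul_mem _ (hP _ (hsum_left v)))) (sum_mem fun l _ => ?_)
  · have := S.smul_mem (s * α) (hQ k hk)
    rw [smul_smul] at this
    convert this using 2
    ring
  · rw [map_smul, smul_comm]
    refine S.smul_mem _ ?_
    by_cases hl : l = i
    · subst hl
      exact hi
    · have := S.smul_mem (s ^ 2 * α ^ 3) (hne l hl)
      rw [smul_smul] at this
      convert this using 2
      ring

/-- Let `u` be isotropic and nonzero modulo the maximal ideal `𝔪`, with respect to the form. Up to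
a denominator outside `𝔪`, every vector orthogonal to `u` is an admissible argument of `σ_{u,·}`. -/
theorem HypSplitting.exists_smul_mem_esdArg (h : HypSplitting q Q₀ P₁ P₂ m) (hm : 2 ≤ m)
    (hG : IsometricAction q G N)
    (h₁ : ∀ a ∈ P₁, IsRootPair q Q₀ G N I a) (h₂ : ∀ a ∈ P₂, IsRootPair q Q₀ G N I a)
    {u d : M} (hu : q u = 0) (𝔪 : Ideal R) (h𝔪 : 𝔪.IsMaximal) (hd : q.polarBilin u d ∉ 𝔪) :
    ∃ t ∉ 𝔪, ∀ v, q.polarBilin u v = 0 → t • v ∈ esdArg q N I u hu := by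
  have hprime := h𝔪.isPrime
  obtain ⟨s, hs, e, ε, hb⟩ := h.exists_dualBasis 𝔪 h𝔪
  have hpow : ∀ {a : R}, a ∉ 𝔪 → s ^ 4 * a ^ 4 ∉ 𝔪 := fun ha hmem =>
    (hprime.mem_or_mem hmem).elim (fun h' => hs (hprime.mem_of_pow_mem _ h'))
      (fun h' => ha (hprime.mem_of_pow_mem _ h'))
  have key₂ : ∀ {w : M} (hw : q w = 0) (i : Fin m), q.polarBilin w (ε i) ∉ 𝔪 →
      ∃ t ∉ 𝔪, ∀ v, q.polarBilin w v = 0 → t • v ∈ esdArg q N I w hw := fun hw i hi =>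
    ⟨_, hpow hi, fun v hv => h.symm.smul_mem_esdArg_of_orth hm hG h₂ h₁ hb.symm hw i hv⟩
  by_cases hα : ∃ i, q.polarBilin u (e i) ∉ 𝔪
  · obtain ⟨i, hi⟩ := hα
    exact ⟨_, hpow hi, fun v hv => h.smul_mem_esdArg_of_orth hm hG h₁ h₂ hb hu i hv⟩
  by_cases hβ : ∃ i, q.polarBilin u (ε i) ∉ 𝔪
  · obtain ⟨i, hi⟩ := hβ
    exact key₂ hu i hi
  push Not at hα hβ
  -- Now `u` is orthogonal to `P₁` and `P₂` modulo `𝔪`; a transvection `σ_{e_i,k}` with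
  -- `⟨u, k⟩ ∉ 𝔪` moves it to a vector pairing nontrivially with `ε_i`.
  obtain ⟨k, hk, hsum⟩ := h.dual_sum hb d
  have huk : q.polarBilin u k ∉ 𝔪 := by
    intro hmem
    have h1 : q.polarBilin u (s • d) ∈ 𝔪 := by
      rw [hsum, map_add, map_add, map_sum, map_sum]
      refine add_mem (add_mem hmem (sum_mem fun l _ => ?_)) (sum_mem fun l _ => ?_) <;>
        rw [map_smul, smul_eq_mul]
      · exact 𝔪.mul_mem_left _ (hα l)
      · exact 𝔪.mul_mem_left _ (hβ l)
    rw [map_smul, smul_eq_mul] at h1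
    exact (hprime.mem_or_mem h1).elim hs hd
  let i : Fin m := ⟨0, by omega⟩
  have hei := h₁ _ (hb.left_mem i)
  obtain ⟨g, hg, hgx⟩ := hei.2.hasEsd k hk 1 trivial
  rw [one_smul] at hgx
  have hiso := hG.map_apply g hg
  have hgu : q.polarBilin (g u) (ε i) ∉ 𝔪 := by
    have hkε : q.polarBilin k (ε i) = 0 := by
      rw [polarBilin_comm, h.orth_right _ (hb.right_mem i) k hk]
    have hval : q.polarBilin (g u) (ε i) = q.polarBilin u (ε i) + q.polarBilin u k * s -
        q k * q.polarBilin u (e i) * s := by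
      rw [hgx, esd, map_sub, map_sub, map_add, LinearMap.sub_apply, LinearMap.sub_apply,
        LinearMap.add_apply, map_smul, map_smul, map_smul, LinearMap.smul_apply,
        LinearMap.smul_apply, LinearMap.smul_apply, hb.pairing, if_pos rfl, hkε,
        polarBilin_comm q k, polarBilin_comm q (e i)]
      simp only [smul_eq_mul, mul_zero, sub_zero]
    intro hmem
    rw [hval] at hmem
    have h1 := sub_mem (add_mem hmem (𝔪.mul_mem_right s (𝔪.mul_mem_left (q k) (hα i)))) (hβ i)
    have h2 : q.polarBilin u k * s ∈ 𝔪 := by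
      convert h1 using 1
      ring
    exact (hprime.mem_or_mem h2).elim huk hs
  obtain ⟨t, ht, htv⟩ := key₂ (w := g u) (by rw [hiso, hu]) i hgu
  refine ⟨t, ht, fun v hv => ?_⟩
  have h1 := hG.mem_esdArg (hu := by rw [hiso, hu]) hu (G.inv_mem hg)
    (by rw [← LinearEquiv.mul_apply, inv_mul_cancel]; rfl)
    (htv (g v) (by rw [polarBilin_map hiso, hv]))
  rw [← map_smul, ← LinearEquiv.mul_apply, inv_mul_cancel] at h1
  exact h1

end Splitting

/-! ### Local dual bases of projective modules -/

section LocalBasis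

/-- A finitely generated projective module of rank `n` at the prime `𝔭` has dual bases of length
`n`, up to a denominator `s ∉ 𝔭`. -/
lemma exists_dualBasis_of_rankAtStalk {R X : Type*} [CommRing R] [AddCommGroup X] [Module R X]
    [Module.Finite R X] [Module.Projective R X] {n : ℕ} (𝔭 : PrimeSpectrum R)
    (hn : Module.rankAtStalk X 𝔭 = n) :
    ∃ s ∉ 𝔭.asIdeal, ∃ (x : Fin n → X) (ξ : Fin n → Module.Dual R X),
      (∀ i j, ξ j (x i) = if i = j then s else 0) ∧ ∀ y, s • y = ∑ i, ξ i y • x i := by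
  have := Module.finitePresentation_of_projective R X
  let S := 𝔭.asIdeal.primeCompl
  let A := Localization.AtPrime 𝔭.asIdeal
  have hfree : Module.Free A (LocalizedModule S X) := Module.free_of_flat_of_isLocalRing
  let b : Module.Basis (Fin n) A (LocalizedModule S X) := Module.finBasisOfFinrankEq _ _ hn
  let φ : LocalizedModule S X ≃ₗ[R] (Fin n → A) := b.equivFun.restrictScalars R
  let mk := LocalizedModule.mkLinearMap S X
  let F : (Fin n → R) →ₗ[R] (Fin n → A) :=
    LinearMap.pi fun i => Algebra.linearMap R A ∘ₗ LinearMap.proj i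
  obtain ⟨h, s, hs⟩ := Module.FinitePresentation.exists_lift_of_isLocalizedModule S F
    (φ.toLinearMap ∘ₗ mk)
  obtain ⟨g, t, ht⟩ := Module.FinitePresentation.exists_lift_of_isLocalizedModule S mk
    (φ.symm.toLinearMap ∘ₗ F)
  have hs' : ∀ y, F (h y) = (s : R) • φ (mk y) := fun y => LinearMap.congr_fun hs y
  have ht' : ∀ y, mk (g y) = (t : R) • φ.symm (F y) := fun y => LinearMap.congr_fun ht y
  obtain ⟨u, hu⟩ := Module.Finite.exists_smul_of_comp_eq_of_isLocalizedModule S F (h ∘ₗ g)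
    ((s * t : R) • LinearMap.id) (by
      refine LinearMap.ext fun y => ?_
      simp only [LinearMap.comp_apply, LinearMap.smul_apply, LinearMap.id_apply, hs', ht',
        map_smul, LinearEquiv.apply_symm_apply, smul_smul])
  obtain ⟨v, hv⟩ := Module.Finite.exists_smul_of_comp_eq_of_isLocalizedModule S mk (g ∘ₗ h)
    ((s * t : R) • LinearMap.id) (by
      refine LinearMap.ext fun y => ?_
      simp only [LinearMap.comp_apply, LinearMap.smul_apply, LinearMap.id_apply, hs', ht',
        map_smul, LinearEquiv.symm_apply_apply, smul_smul, mul_comm])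
  refine ⟨u * v * (s * t : R), (u * v * (s * t)).2, fun i => g (Pi.single i 1),
    fun i => (u * v : R) • (LinearMap.proj i ∘ₗ h), fun i j => ?_, fun y => ?_⟩
  · have h1 := congrFun (LinearMap.congr_fun hu (Pi.single i 1)) j
    have h2 : (u : R) * h (g (Pi.single i 1)) j = u * (s * t * Pi.single (M := fun _ => R) i 1 j) :=
      h1
    simp only [LinearMap.smul_apply, LinearMap.comp_apply, LinearMap.proj_apply, smul_eq_mul]
    rw [mul_right_comm, h2, Pi.single_apply]
    simp only [eq_comm (a := j)]
    split_ifs <;> ring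
  · have h1 : (v : R) • g (h y) = (v : R) • (s * t : R) • y := LinearMap.congr_fun hv y
    have h2 : g (h y) = ∑ i, h y i • g (Pi.single i 1) := by
      conv_lhs => rw [pi_eq_sum_univ' (h y)]
      simp only [map_sum, map_smul]
    simp only [LinearMap.smul_apply, LinearMap.comp_apply, LinearMap.proj_apply, smul_eq_mul,
      mul_smul, ← Finset.smul_sum, ← h2]
    rw [h1, mul_smul]

end LocalBasis

/-! ### Relative normal closures -/

section NormalClosure
variable {A : Type*} [Group A] {H G : Subgroup A}

lemma le_normalClosureIn (h : H ≤ G) : H ≤ normalClosureIn H G := fun x hx =>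
  ⟨⟨x, h hx⟩, Subgroup.subset_normalClosure hx, rfl⟩

lemma normalClosureIn_conj_mem {g n : A} (hg : g ∈ G) (hn : n ∈ normalClosureIn H G) :
    g * n * g⁻¹ ∈ normalClosureIn H G := by
  obtain ⟨n, hn, rfl⟩ := hn
  exact ⟨⟨g, hg⟩ * n * ⟨g, hg⟩⁻¹, Subgroup.normalClosure_normal.conj_mem n hn _, rfl⟩

lemma normalClosureIn_le {K : Subgroup A} (h : H ≤ K)
    (hK : ∀ g ∈ G, ∀ n ∈ K, g * n * g⁻¹ ∈ K) : normalClosureIn H G ≤ K := by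
  have : (K.subgroupOf G).Normal := ⟨fun n hn g => hK g g.2 n hn⟩
  have h1 : Subgroup.normalClosure ((H.subgroupOf G : Subgroup G) : Set G) ≤ K.subgroupOf G :=
    Subgroup.normalClosure_le_normal fun x hx => h hx
  rintro _ ⟨n, hn, rfl⟩
  exact h1 hn

lemma normalClosureIn_self : normalClosureIn G G = G :=
  le_antisymm (normalClosureIn_le le_rfl fun _ hg _ hn => G.mul_mem (G.mul_mem hg hn)
    (G.inv_mem hg)) (le_normalClosureIn le_rfl)

lemma isometry_of_mem_closure {R M : Type*} [CommRing R] [AddCommGroup M] [Module R M]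
    {q : QuadraticForm R M} {S : Set (M ≃ₗ[R] M)} (h : ∀ g ∈ S, ∀ x, q (g x) = q x)
    (g : M ≃ₗ[R] M) (hg : g ∈ Subgroup.closure S) : ∀ x, q (g x) = q x := by
  induction hg using Subgroup.closure_induction with
  | mem g hg => exact h g hg
  | one => exact fun x => rfl
  | mul a b _ _ ha hb => exact fun x => by rw [LinearEquiv.mul_apply, ha, hb]
  | inv a _ ha =>
    intro x
    rw [← ha (a⁻¹ x), ← LinearEquiv.mul_apply, mul_inv_cancel]
    rfl

end NormalClosure

/-! ### Linear maps as sums of rank one maps -/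

section Decomposition
variable {R Q X : Type*} [CommRing R] [AddCommGroup Q] [Module R Q] [Module.Finite R Q]
  [Module.Projective R Q] [AddCommGroup X] [Module R X] [Module.Finite R X]

/-- A linear map with values in `I X`, on a non-degenerate module, is a finite sum of maps
`z ↦ ⟨r w, z⟩ p` with `r ∈ I`. -/
lemma exists_sum_of_forall_mem {q : QuadraticForm R Q} (hq : IsNondegenerate q) (I : Ideal R)
    (α : Q →ₗ[R] X) (hα : ∀ z, α z ∈ I • (⊤ : Submodule R X)) :
    ∃ (k l : ℕ) (w : Fin k × Fin l → Q) (r : Fin k × Fin l → R) (p : Fin k × Fin l → X),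
      (∀ i, r i ∈ I) ∧ ∀ z, α z = ∑ i, q.polarBilin (r i • w i) z • p i := by
  obtain ⟨k, f, g, -, -, hfg⟩ := Module.Finite.exists_comp_eq_id_of_projective R Q
  obtain ⟨l, x, hx⟩ := Module.Finite.exists_fin (R := R) (M := X)
  have h1 : ∀ a : Fin k, ∃ c : Fin l → R, (∀ i, c i ∈ I) ∧
      α (f (Pi.single a 1)) = ∑ i, c i • x i := fun a => by
    have h2 := hα (f (Pi.single a 1))
    rw [← hx, Submodule.mem_ideal_smul_span_iff_exists_sum] at h2
    obtain ⟨c, hc, hsum⟩ := h2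
    refine ⟨c, hc, ?_⟩
    rw [← hsum, Finsupp.sum_fintype _ _ (by simp)]
  choose c hc hcx using h1
  choose w hw using fun a : Fin k => hq.2 (LinearMap.proj a ∘ₗ g)
  refine ⟨k, l, fun i => w i.1, fun i => c i.1 i.2, fun i => x i.2, fun i => hc _ _,
    fun z => ?_⟩
  have h2 : z = ∑ a, g z a • f (Pi.single a 1) := by
    have h3 : f (g z) = z := LinearMap.congr_fun hfg z
    conv_lhs => rw [← h3, pi_eq_sum_univ' (g z)]
    simp only [map_sum, map_smul]
  have h3 : ∀ a, q.polarBilin (w a) z = g z a := fun a => by rw [hw]; rfl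
  conv_lhs => rw [h2]
  rw [Fintype.sum_prod_type, map_sum]
  refine Finset.sum_congr rfl fun a _ => ?_
  rw [map_smul, hcx, Finset.smul_sum]
  refine Finset.sum_congr rfl fun i _ => ?_
  rw [map_smul, LinearMap.smul_apply, h3, smul_smul, smul_eq_mul, mul_comm]

end Decomposition

/-! ### Products of transvections along a totally isotropic family -/

section PartialSum
variable {R M ι : Type*} [CommRing R] [AddCommGroup M] [Module R M]
  {q : QuadraticForm R M} {N : Subgroup (M ≃ₗ[R] M)}

/-- The endomorphism `x ↦ ∑ i ∈ s, ⟨w i, x⟩ p i`. -/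
def sumTensor (q : QuadraticForm R M) (s : Finset ι) (p w : ι → M) : M →ₗ[R] M :=
  ∑ i ∈ s, (q.polarBilin (w i)).smulRight (p i)

lemma sumTensor_apply (s : Finset ι) (p w : ι → M) (x : M) :
    sumTensor q s p w x = ∑ i ∈ s, q.polarBilin (w i) x • p i := by
  simp [sumTensor, LinearMap.sum_apply]

lemma polarBilin_sumTensor_eq_zero {s : Finset ι} {p w : ι → M} {z : M}
    (h : ∀ i, q.polarBilin z (p i) = 0) (x : M) :
    q.polarBilin z (sumTensor q s p w x) = 0 := by
  rw [sumTensor_apply, map_sum]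
  exact Finset.sum_eq_zero fun i _ => by rw [map_smul, h, smul_zero]

lemma polarBilin_sumTensor_left (s : Finset ι) (p w : ι → M) (x y : M) :
    q.polarBilin (sumTensor q s p w x) y = q.polarBilin x (sumTensor q s w p y) := by
  rw [sumTensor_apply, sumTensor_apply, map_sum, map_sum, LinearMap.sum_apply]
  refine Finset.sum_congr rfl fun i _ => ?_
  rw [map_smul, map_smul, LinearMap.smul_apply, smul_eq_mul, smul_eq_mul, mul_comm,
    polarBilin_comm q (w i)]

lemma HasEsd.sum {u : M} (hu : q u = 0) {f : ι → M} (hf : ∀ i, HasEsd q N u (f i))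
    (huf : ∀ i, q.polarBilin u (f i) = 0) (s : Finset ι) : HasEsd q N u (∑ i ∈ s, f i) := by
  classical
  induction s using Finset.induction_on with
  | empty => simpa using hasEsd_zero u
  | insert i s hi ih =>
    rw [Finset.sum_insert hi]
    exact (hf i).add ih hu (huf i) (by rw [map_sum, Finset.sum_eq_zero fun j _ => huf j])

/-- If the `p i` are isotropic and orthogonal to each other and to the `w i`, the product of the
`σ_{p i, w i}` is, up to transvections along the planes of the `p i`, the unipotent map
`x ↦ x + A x - A^* x - (1/2) A A^* x` with `A = ∑ ⟨w i, ·⟩ p i`, `A^* = ∑ ⟨p i, ·⟩ w i`. -/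
lemma exists_mem_unipotent [Invertible (2 : R)] (p w : ι → M) (hp : ∀ i, q (p i) = 0)
    (hpp : ∀ i j, q.polarBilin (p i) (p j) = 0) (hpw : ∀ i j, q.polarBilin (p i) (w j) = 0)
    (h1 : ∀ i, HasEsd q N (p i) (w i))
    (h2 : ∀ i j, HasEsd q N (p i) ((⅟(2 : R) * q.polarBilin (w j) (w i)) • p j))
    (s : Finset ι) :
    ∃ g ∈ N, ∀ x, g x = x + sumTensor q s p w x - sumTensor q s w p x -
      ⅟(2 : R) • sumTensor q s p w (sumTensor q s w p x) := by
  classical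
  induction s using Finset.induction_on with
  | empty => exact ⟨1, N.one_mem, fun x => by simp [sumTensor]⟩
  | insert i s hi ih =>
    obtain ⟨g, hg, hgx⟩ := ih
    obtain ⟨g₁, hg₁, hgx₁⟩ := h1 i
    -- the correction term `σ_{p i, (1/2) A (w i)}`
    obtain ⟨g₂, hg₂, hgx₂⟩ : HasEsd q N (p i) (⅟(2 : R) • sumTensor q s p w (w i)) := by
      rw [sumTensor_apply, Finset.smul_sum]
      simp only [smul_smul]
      exact HasEsd.sum (hp i) (h2 i) (fun j => by rw [map_smul, hpp, smul_zero]) s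
    refine ⟨g₂ * g₁ * g, N.mul_mem (N.mul_mem hg₂ hg₁) hg, fun x => ?_⟩
    have hwp : ∀ a b, q.polarBilin (w a) (p b) = 0 := fun a b => by rw [polarBilin_comm, hpw]
    have hpA : ∀ j z, q.polarBilin (p j) (sumTensor q s p w z) = 0 := fun j z =>
      polarBilin_sumTensor_eq_zero (hpp j) z
    have hpB : ∀ j z, q.polarBilin (p j) (sumTensor q s w p z) = 0 := fun j z =>
      polarBilin_sumTensor_eq_zero (hpw j) z
    have hwA : ∀ j z, q.polarBilin (w j) (sumTensor q s p w z) = 0 := fun j z =>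
      polarBilin_sumTensor_eq_zero (hwp j) z
    have hBA : ∀ z, sumTensor q s w p (sumTensor q s p w z) = 0 := fun z => by
      rw [sumTensor_apply]
      exact Finset.sum_eq_zero fun j _ => by rw [hpA, zero_smul]
    have hBB : ∀ z, sumTensor q s w p (sumTensor q s w p z) = 0 := fun z => by
      rw [sumTensor_apply]
      exact Finset.sum_eq_zero fun j _ => by rw [hpB, zero_smul]
    have hBp : sumTensor q s w p (p i) = 0 := by
      rw [sumTensor_apply]
      exact Finset.sum_eq_zero fun j _ => by rw [hpp, zero_smul]
    have hBw : sumTensor q s w p (w i) = 0 := by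
      rw [sumTensor_apply]
      exact Finset.sum_eq_zero fun j _ => by rw [hpw, zero_smul]
    have hqA : q (sumTensor q s p w (w i)) = 0 := by
      have h3 := polarBilin_self q (sumTensor q s p w (w i))
      rw [polarBilin_sumTensor_left, hBA, map_zero] at h3
      rw [← invOf_mul_cancel_left (2 : R) (q _), ← h3, mul_zero]
    have hinsert : ∀ (a b : ι → M) z, sumTensor q (insert i s) a b z =
        q.polarBilin (b i) z • a i + sumTensor q s a b z := fun a b z => by
      rw [sumTensor_apply, sumTensor_apply, Finset.sum_insert hi]
    have hhalf : (⅟(2 : R) * 2) • p i = p i := by rw [invOf_mul_self, one_smul]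
    have hww := polarBilin_self q (w i)
    rw [LinearEquiv.mul_apply, LinearEquiv.mul_apply, hgx₂, hgx₁, hgx]
    simp only [esd, hinsert, map_add, map_sub, map_smul, LinearMap.smul_apply, smul_eq_mul,
      polarBilin_sumTensor_left, hpp, hpw, hpA, hpB, hwA, hBA, hBB, hBp,
      hBw, map_zero, hqA, map_smul_sq, hww]
    linear_combination (norm := module)
      (q.polarBilin (p i) x * q (w i) + q.polarBilin (w i) (sumTensor q s w p x)) • hhalf

end PartialSum

/-! ### Complements of hyperbolic families -/

section Trace
variable {R M : Type*} [CommRing R] [AddCommGroup M] [Module R M] {q : QuadraticForm R M}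

/-- The orthogonal complement of the vectors `e i`, `ε i`. -/
def hypCompl (q : QuadraticForm R M) {m : ℕ} (e ε : Fin m → M) : Submodule R M :=
  ⨅ i, LinearMap.ker (q.polarBilin (e i)) ⊓ LinearMap.ker (q.polarBilin (ε i))

lemma mem_hypCompl {m : ℕ} {e ε : Fin m → M} {k : M} : k ∈ hypCompl q e ε ↔
    ∀ i, q.polarBilin (e i) k = 0 ∧ q.polarBilin (ε i) k = 0 := by
  simp [hypCompl, Submodule.mem_iInf, -QuadraticMap.polarBilin_apply_apply]

lemma sub_sum_mem_hypCompl {m : ℕ} {e ε : Fin m → M}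
    (hee : ∀ i j, q.polarBilin (e i) (e j) = 0) (hεε : ∀ i j, q.polarBilin (ε i) (ε j) = 0)
    (heε : ∀ i j, q.polarBilin (e i) (ε j) = if i = j then 1 else 0) (x : M) :
    x - ∑ l, q.polarBilin x (ε l) • e l - ∑ l, q.polarBilin x (e l) • ε l ∈
      hypCompl q e ε := by
  have hεe : ∀ i j, q.polarBilin (ε i) (e j) = if i = j then 1 else 0 := fun i j => by
    rw [polarBilin_comm, heε]
    simp only [eq_comm]
  refine mem_hypCompl.2 fun i => ?_
  constructor <;>
  · simp only [map_sub, map_sum, map_smul, hee, hεε, heε, hεe, smul_eq_mul, mul_zero,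
      Finset.sum_const_zero, mul_ite, mul_one, Finset.sum_ite_eq, Finset.mem_univ, if_true,
      sub_zero]
    rw [polarBilin_comm, sub_self]

/-- If `e`, `ε` span a hyperbolic space of rank `m` and the form takes, up to a denominator
outside `𝔪`, an identity matrix of size greater than `2 m` as values, then on the orthogonal
complement of `e`, `ε` it takes a value outside `𝔪`: otherwise the identity matrix would factor
modulo `𝔪` through a space of dimension `2 m`. -/
lemma exists_polarBilin_notMem {m : ℕ} {ι : Type*} [Fintype ι] [DecidableEq ι]
    (hι : 2 * m < Fintype.card ι) (𝔪 : Ideal R) (h𝔪 : 𝔪.IsMaximal) {s : R} (hs : s ∉ 𝔪)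
    (v w : ι → M) (hvw : ∀ i j, q.polarBilin (v i) (w j) = if i = j then s else 0)
    (e ε : Fin m → M) (hee : ∀ i j, q.polarBilin (e i) (e j) = 0)
    (hεε : ∀ i j, q.polarBilin (ε i) (ε j) = 0)
    (heε : ∀ i j, q.polarBilin (e i) (ε j) = if i = j then 1 else 0) :
    ∃ k ∈ hypCompl q e ε, ∃ k' ∈ hypCompl q e ε, q.polarBilin k k' ∉ 𝔪 := by
  by_contra! hcon
  let π : M → M := fun x =>
    x - ∑ l, q.polarBilin x (ε l) • e l - ∑ l, q.polarBilin x (e l) • ε l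
  have hmem : ∀ x, π x ∈ hypCompl q e ε := sub_sum_mem_hypCompl hee hεε heε
  have hπ : ∀ x i, q.polarBilin (e i) (π x) = 0 ∧ q.polarBilin (ε i) (π x) = 0 := fun x =>
    mem_hypCompl.1 (hmem x)
  have hkey : ∀ x y, q.polarBilin x y -
      (∑ l, q.polarBilin x (ε l) * q.polarBilin (e l) y +
        ∑ l, q.polarBilin x (e l) * q.polarBilin (ε l) y) ∈ 𝔪 := fun x y => by
    have h1 := hcon (π x) (hmem x) (π y) (hmem y)
    have h2 : q.polarBilin (π x) (π y) = q.polarBilin x (π y) := by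
      conv_lhs => enter [1, 2]; simp only [π]
      simp only [map_sub, map_sum, map_smul, LinearMap.sub_apply, LinearMap.sum_apply,
        LinearMap.smul_apply, (hπ y _).1, (hπ y _).2, smul_zero, Finset.sum_const_zero, sub_zero]
    rw [h2] at h1
    have h3 : q.polarBilin x (π y) = q.polarBilin x y -
        (∑ l, q.polarBilin x (ε l) * q.polarBilin (e l) y +
          ∑ l, q.polarBilin x (e l) * q.polarBilin (ε l) y) := by
      simp only [π, map_sub, map_sum, map_smul, smul_eq_mul]
      rw [sub_sub, add_comm]
      simp only [polarBilin_comm q y, mul_comm]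
    rwa [h3] at h1
  let K := R ⧸ 𝔪
  let _ : Field K := Ideal.Quotient.field 𝔪
  let f : R →+* K := Ideal.Quotient.mk 𝔪
  let X : Matrix ι (Fin m ⊕ Fin m) K := Matrix.of fun i => Sum.elim
    (fun l => f (q.polarBilin (v i) (ε l))) (fun l => f (q.polarBilin (v i) (e l)))
  let Y : Matrix (Fin m ⊕ Fin m) ι K := Matrix.of <| Sum.elim
    (fun l j => f (q.polarBilin (e l) (w j))) (fun l j => f (q.polarBilin (ε l) (w j)))
  have hXY : X * Y = f s • (1 : Matrix ι ι K) := by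
    ext i j
    have h1 := (Ideal.Quotient.eq (I := 𝔪)).2 (hkey (v i) (w j))
    rw [hvw] at h1
    rw [Matrix.mul_apply, Fintype.sum_sum_type, Matrix.smul_apply, Matrix.one_apply]
    have h2 : (f s • if i = j then (1 : K) else 0) = f (if i = j then s else 0) := by
      split_ifs <;> simp
    rw [h2]
    refine Eq.trans ?_ h1.symm
    simp [X, Y, f, -QuadraticMap.polarBilin_apply_apply]
  have hunit : IsUnit (X * Y) := by
    have hfs : f s ≠ 0 := fun h => hs (Ideal.Quotient.eq_zero_iff_mem.1 h)
    rw [hXY]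
    exact (Units.mk0 _ hfs • (1 : (Matrix ι ι K)ˣ)).isUnit
  have h1 := Matrix.rank_of_isUnit _ hunit
  have h2 := (Matrix.rank_mul_le_left X Y).trans (Matrix.rank_le_card_width X)
  rw [h1, Fintype.card_sum, Fintype.card_fin] at h2
  omega

end Trace

/-! ### From local to global -/

section Globalise
variable {R M : Type*} [CommRing R] [AddCommGroup M] [Module R M]
  {q : QuadraticForm R M} {G N : Subgroup (M ≃ₗ[R] M)} {I : Ideal R}

/-- Every isotropic `u` that is nonzero modulo a maximal ideal `𝔪`, with respect to the form, has
all vectors of `u^⊥` as admissible arguments of `σ_{u,·}`, up to a denominator outside `𝔪`. -/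
def LocallyHasEsd (q : QuadraticForm R M) (N : Subgroup (M ≃ₗ[R] M)) (I : Ideal R) : Prop :=
  ∀ (u d : M) (hu : q u = 0) (𝔪 : Ideal R), 𝔪.IsMaximal → q.polarBilin u d ∉ 𝔪 →
    ∃ t ∉ 𝔪, ∀ v, q.polarBilin u v = 0 → t • v ∈ esdArg q N I u hu

/-- Once `⟨u, d⟩ = 1`, every `v ∈ I M` orthogonal to `u` is a combination with coefficients in `I`
of vectors orthogonal to `u`, namely of the contractions of `d ∧ x` with `u`. -/
lemma LocallyHasEsd.hasEsd_of_unimodular (h : LocallyHasEsd q N I) {u d v : M} (hu : q u = 0)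
    (hd : q.polarBilin u d = 1) (hv : v ∈ I • (⊤ : Submodule R M))
    (huv : q.polarBilin u v = 0) : HasEsd q N u v := by
  have h1 : ∀ x, q.polarBilin u x = 0 → x ∈ esdArg q N I u hu := fun x hx =>
    mem_of_forall_maximal _ _ fun 𝔪 h𝔪 => by
      obtain ⟨t, ht, htv⟩ := h u d hu 𝔪 h𝔪 (by
        rw [hd]
        exact fun h1 => h𝔪.ne_top ((Ideal.eq_top_iff_one _).2 h1))
      exact ⟨t, ht, htv x hx⟩
  let κ : M →ₗ[R] M := LinearMap.id - (LinearMap.toSpanSingleton R M d) ∘ₗ (q.polarBilin u)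
  have hκ : ∀ x, κ x = x - q.polarBilin u x • d := fun x => by simp [κ]
  have hκu : ∀ x, q.polarBilin u (κ x) = 0 := fun x => by
    rw [hκ, map_sub, map_smul, hd, smul_eq_mul, mul_one, sub_self]
  have h2 : HasEsd q N u (κ v) := by
    refine Submodule.smul_induction_on hv (fun r hr x _ => ?_) (fun x y hx hy => ?_)
    · rw [map_smul]
      exact (h1 _ (hκu x)).2 r hr
    · rw [map_add]
      exact hx.add hy hu (hκu x) (hκu y)
  rwa [hκ, huv, zero_smul, sub_zero] at h2

/-- The transvections along all, not only the unimodular, vectors `p` of a locally free totally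
isotropic submodule `P₁`: locally `p` is a combination of isotropic vectors to which
`LocallyHasEsd` applies. -/
lemma LocallyHasEsd.hasEsd_of_isotropic (h : LocallyHasEsd q N I) {Q₀ P₁ P₂ : Submodule R M}
    {m : ℕ} (hS : HypSplitting q Q₀ P₁ P₂ m) {p v : M} (hp : p ∈ P₁)
    (hv : ∀ a ∈ P₁, q.polarBilin a v = 0) {r : R} (hr : r ∈ I) : HasEsd q N p (r • v) := by
  let X : Submodule R M :=
    { carrier := {p | p ∈ P₁ ∧ ∀ v, (∀ a ∈ P₁, q.polarBilin a v = 0) → ∀ r ∈ I,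
        HasEsd q N p (r • v)}
      add_mem' := by
        rintro a b ⟨ha, ha'⟩ ⟨hb, hb'⟩
        refine ⟨P₁.add_mem ha hb, fun v hv r hr => ?_⟩
        refine (ha' v hv r hr).add_left (hb' v hv r hr) ?_ (hS.isotropic_left a ha)
          (hS.isotropic_left b hb) (hS.polarBilin_left ha hb) (by rw [map_smul, hv a ha, smul_zero])
          (by rw [map_smul, hv b hb, smul_zero])
        rw [map_smul_sq, mul_assoc, mul_smul]
        exact ha' _ (fun c hc => by
          rw [map_smul, hS.polarBilin_left hc hb, smul_zero]) r hr
      zero_mem' := ⟨P₁.zero_mem, fun v _ r _ => by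
        have h1 : HasEsd q N ((0 : R) • (0 : M)) (r • v) := by
          rw [hasEsd_smul_left, zero_smul]
          exact hasEsd_zero 0
        rwa [zero_smul] at h1⟩
      smul_mem' := by
        rintro t a ⟨ha, ha'⟩
        refine ⟨P₁.smul_mem t ha, fun v hv r hr => ?_⟩
        rw [hasEsd_smul_left, smul_smul]
        exact ha' v hv _ (I.mul_mem_left t hr) }
  suffices h1 : p ∈ X from h1.2 v hv r hr
  refine mem_of_forall_maximal _ _ fun 𝔪 h𝔪 => ?_
  have hprime := h𝔪.isPrime
  obtain ⟨s, hs, e, ε, hb⟩ := hS.exists_dualBasis 𝔪 h𝔪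
  have h2 : ∀ i, ∃ t ∉ 𝔪, t • e i ∈ X := fun i => by
    obtain ⟨t, ht, htv⟩ := h (e i) (ε i) (hS.isotropic_left _ (hb.left_mem i)) 𝔪 h𝔪
      (by rwa [hb.pairing, if_pos rfl])
    refine ⟨t, ht, P₁.smul_mem t (hb.left_mem i), fun v hv r hr => ?_⟩
    rw [hasEsd_smul_left, smul_comm]
    exact (htv v (hv _ (hb.left_mem i))).2 r hr
  choose t ht htX using h2
  refine ⟨(∏ i, t i) * s, fun hmem => ?_, ?_⟩
  · rcases hprime.mem_or_mem hmem with h3 | h3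
    · obtain ⟨i, -, hi⟩ := (hprime.prod_mem_iff).1 h3
      exact ht i hi
    · exact hs h3
  · rw [mul_smul, hb.left_sum p hp, Finset.smul_sum]
    refine sum_mem fun i _ => ?_
    obtain ⟨c, hc⟩ := Finset.dvd_prod_of_mem t (Finset.mem_univ i)
    rw [smul_comm, hc, mul_comm (t i) c, mul_smul]
    exact X.smul_mem _ (X.smul_mem c (htX i))

lemma HypSplitting.locallyHasEsd {Q₀ P₁ P₂ : Submodule R M} {m : ℕ}
    (h : HypSplitting q Q₀ P₁ P₂ m) (hm : 2 ≤ m) (hG : IsometricAction q G N)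
    (h₁ : ∀ a ∈ P₁, IsRootPair q Q₀ G N I a) (h₂ : ∀ a ∈ P₂, IsRootPair q Q₀ G N I a) :
    LocallyHasEsd q N I := fun _ _ hu 𝔪 h𝔪 hd =>
  h.exists_smul_mem_esdArg hm hG h₁ h₂ hu 𝔪 h𝔪 hd

end Globalise

/-! ### Transvection groups -/

section TransO
variable {R M : Type*} [CommRing R] [AddCommGroup M] [Module R M] (q : QuadraticForm R M)

lemma transOTrue_le_transO (I : Ideal R) : transOTrue q I ≤ transO q :=
  Subgroup.closure_mono fun _ ⟨u, v, h1, h2, h3, h4, h5⟩ =>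
    ⟨u, v, h1, h2, h3, Submodule.smul_mono_left le_top h4, h5⟩

lemma isometricAction_transO (I : Ideal R) :
    IsometricAction q (transO q) (transORel q I) where
  map_apply := isometry_of_mem_closure fun g ⟨u, v, _, h2, h3, _, h5⟩ x => by
    rw [h5, map_esd q h2 h3]
  conj_mem _ hg _ hn := normalClosureIn_conj_mem hg hn

/-- Unimodular isotropic vectors are roots for the transvection groups. -/
lemma isRootPair_transO {Q₀ : Submodule R M} {I : Ideal R} {u d : M} (hu : q u = 0)
    (hd : q.polarBilin u d = 1) (hQ : ∀ k ∈ Q₀, q.polarBilin u k = 0) :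
    IsRootPair q Q₀ (transO q) (transORel q I) I u := by
  have h1 : ∀ J : Ideal R, ∀ k ∈ Q₀, ∀ r ∈ J, HasEsd q (transOTrue q J) u (r • k) :=
    fun J k hk r hr => by
      have h2 : q.polarBilin u (r • k) = 0 := by rw [map_smul, hQ k hk, smul_zero]
      refine ⟨esdEquiv q u (r • k) hu h2, Subgroup.subset_closure ?_, fun x => rfl⟩
      refine ⟨u, r • k, ⟨q.polarBilin d, by rw [polarBilin_comm, hd]⟩, hu, h2,
        Submodule.smul_mem_smul hr trivial, fun x => rfl⟩
  exact ⟨⟨hu, hQ, fun k hk r hr => (h1 I k hk r hr).mono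
    (le_normalClosureIn (transOTrue_le_transO q I))⟩, ⟨hu, hQ, h1 ⊤⟩⟩

end TransO

/-! ### Splitting off a hyperbolic family -/

section HyperbolicRank
variable {R M : Type*} [CommRing R] [AddCommGroup M] [Module R M] {q : QuadraticForm R M}

lemma polarBilin_dualProd {X : Type*} [AddCommGroup X] [Module R X]
    (x y : Module.Dual R X × X) :
    (QuadraticForm.dualProd R X).polarBilin x y = x.1 y.2 + y.1 x.2 := by
  simp [QuadraticMap.polar]
  ring

lemma exists_hyperbolic_basis {m : ℕ} (h : HyperbolicRankGE q m) : ∃ e ε : Fin m → M,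
    (∀ i, q (e i) = 0) ∧ (∀ i, q (ε i) = 0) ∧ (∀ i j, q.polarBilin (e i) (e j) = 0) ∧
    (∀ i j, q.polarBilin (ε i) (ε j) = 0) ∧
    (∀ i j, q.polarBilin (e i) (ε j) = if i = j then 1 else 0) := by
  obtain ⟨f⟩ := h
  have hf : ∀ x y, q.polarBilin (f x) (f y) =
      (QuadraticForm.dualProd R (Fin m → R)).polarBilin x y := fun x y => by
    simp only [QuadraticMap.polarBilin_apply_apply, QuadraticMap.polar, ← map_add, f.map_app]
  refine ⟨fun i => f (0, Pi.single i 1), fun i => f (LinearMap.proj i, 0), ?_, ?_, ?_, ?_, ?_⟩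
  · intro i
    rw [f.map_app]
    simp
  · intro i
    rw [f.map_app]
    simp
  · intro i j
    rw [hf, polarBilin_dualProd]
    simp
  · intro i j
    rw [hf, polarBilin_dualProd]
    simp
  · intro i j
    rw [hf, polarBilin_dualProd]
    simp [Pi.single_apply, eq_comm]

variable {m : ℕ} {e ε : Fin m → M}

lemma polarBilin_eq_zero_of_mem_span {v : M} {x : M} (hx : x ∈ Submodule.span R (Set.range e))
    (h : ∀ i, q.polarBilin (e i) v = 0) : q.polarBilin x v = 0 := by
  have h1 : Submodule.span R (Set.range e) ≤ LinearMap.ker (q.polarBilin v) := by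
    rw [Submodule.span_le]
    rintro _ ⟨i, rfl⟩
    rw [SetLike.mem_coe, LinearMap.mem_ker, polarBilin_comm, h]
  rw [polarBilin_comm]
  exact h1 hx

lemma isotropic_of_mem_span (he : ∀ i, q (e i) = 0) (hee : ∀ i j, q.polarBilin (e i) (e j) = 0)
    {x : M} (hx : x ∈ Submodule.span R (Set.range e)) : q x = 0 := by
  induction hx using Submodule.span_induction with
  | mem x hx =>
    obtain ⟨i, rfl⟩ := hx
    exact he i
  | zero => exact QuadraticMap.map_zero q
  | add x y hx hy h1 h2 =>
    rw [map_add_polarBilin, h1, h2, polarBilin_eq_zero_of_mem_span hx fun i => ?_]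
    · simp
    · rw [polarBilin_comm]
      exact polarBilin_eq_zero_of_mem_span hy fun j => hee j i
  | smul r x _ h1 => rw [map_smul_sq, h1, mul_zero]

lemma eq_sum_of_mem_span (heε : ∀ i j, q.polarBilin (e i) (ε j) = if i = j then 1 else 0)
    {x : M} (hx : x ∈ Submodule.span R (Set.range e)) :
    x = ∑ i, q.polarBilin x (ε i) • e i := by
  induction hx using Submodule.span_induction with
  | mem x hx =>
    obtain ⟨i, rfl⟩ := hx
    simp only [heε, ite_smul, one_smul, zero_smul, Finset.sum_ite_eq, Finset.mem_univ, if_true]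
  | zero => simp
  | add x y _ _ h1 h2 =>
    simp only [map_add, LinearMap.add_apply, add_smul, Finset.sum_add_distrib, ← h1, ← h2]
  | smul r x _ h1 =>
    simp only [map_smul, LinearMap.smul_apply, smul_assoc, ← Finset.smul_sum, ← h1]

/-- A hyperbolic family splits off, with its orthogonal complement as the remaining summand. -/
lemma hypSplitting_hypCompl (he : ∀ i, q (e i) = 0) (hε : ∀ i, q (ε i) = 0)
    (hee : ∀ i j, q.polarBilin (e i) (e j) = 0) (hεε : ∀ i j, q.polarBilin (ε i) (ε j) = 0)
    (heε : ∀ i j, q.polarBilin (e i) (ε j) = if i = j then 1 else 0)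
    (htr : HasUnitTrace q (hypCompl q e ε)) :
    HypSplitting q (hypCompl q e ε) (Submodule.span R (Set.range e))
      (Submodule.span R (Set.range ε)) m where
  isotropic_left _ := isotropic_of_mem_span he hee
  isotropic_right _ := isotropic_of_mem_span hε hεε
  orth_left a ha k hk := polarBilin_eq_zero_of_mem_span ha fun i => (mem_hypCompl.1 hk i).1
  orth_right a ha k hk := polarBilin_eq_zero_of_mem_span ha fun i => (mem_hypCompl.1 hk i).2
  exists_add x := by
    exact ⟨_, sub_sum_mem_hypCompl hee hεε heε x, _, sum_mem fun l _ => Submodule.smul_mem _ _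
      (Submodule.subset_span ⟨l, rfl⟩), _, sum_mem fun l _ => Submodule.smul_mem _ _
      (Submodule.subset_span ⟨l, rfl⟩), by abel⟩
  unitTrace := htr
  exists_dualBasis 𝔪 h𝔪 := by
    refine ⟨1, fun h1 => h𝔪.ne_top ((Ideal.eq_top_iff_one _).2 h1), e, ε,
      fun i => Submodule.subset_span ⟨i, rfl⟩, fun i => Submodule.subset_span ⟨i, rfl⟩, heε,
      fun x hx => ?_, fun x hx => ?_⟩
    · rw [one_smul]
      exact eq_sum_of_mem_span heε hx
    · rw [one_smul]
      refine eq_sum_of_mem_span (fun i j => ?_) hx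
      rw [polarBilin_comm, heε]
      simp only [eq_comm]

/-- The vectors in the span of a hyperbolic family are roots for the transvection groups: the
members of the family are unimodular. -/
lemma isRootPair_of_mem_span {I : Ideal R} (he : ∀ i, q (e i) = 0)
    (hee : ∀ i j, q.polarBilin (e i) (e j) = 0)
    (heε : ∀ i j, q.polarBilin (e i) (ε j) = if i = j then 1 else 0)
    {Q₀ : Submodule R M} (hQ : ∀ i, ∀ k ∈ Q₀, q.polarBilin (e i) k = 0)
    (htr : HasUnitTrace q Q₀) {x : M} (hx : x ∈ Submodule.span R (Set.range e)) :
    IsRootPair q Q₀ (transO q) (transORel q I) I x := by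
  have hroot : ∀ i, IsRootPair q Q₀ (transO q) (transORel q I) I (e i) := fun i =>
    isRootPair_transO q (he i) (by rw [heε i i, if_pos rfl]) (hQ i)
  have hG := isometricAction_transO q I
  induction hx using Submodule.span_induction with
  | mem x hx =>
    obtain ⟨i, rfl⟩ := hx
    exact hroot i
  | zero =>
    have h1 : ∀ N : Subgroup (M ≃ₗ[R] M), ∀ J : Ideal R, IsRoot q Q₀ N J 0 := fun N J =>
      ⟨QuadraticMap.map_zero q, fun k _ => by simp, fun k _ r _ =>
        ⟨1, N.one_mem, fun x => by simp [esd]⟩⟩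
    exact ⟨h1 _ _, h1 _ _⟩
  | add x y hx hy h1 h2 =>
    refine h1.add hG htr h2 (polarBilin_eq_zero_of_mem_span hx fun i => ?_)
    rw [polarBilin_comm]
    exact polarBilin_eq_zero_of_mem_span hy fun j => hee j i
  | smul r x _ h1 => exact h1.smul r

end HyperbolicRank

/-! ### The orthogonal sum of `Q` and a hyperbolic space, and its DSER group -/

section Dser
variable {R Q P M : Type*} [CommRing R] [AddCommGroup Q] [Module R Q]
  [AddCommGroup P] [Module R P] [AddCommGroup M] [Module R M]
  {q : QuadraticForm R Q} {q' : QuadraticForm R M}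
  (e : QuadraticMap.IsometryEquiv (sumHyp P q) q')

/-- The inclusion of `Q` in `M = Q ⊥ H(P)`. -/
def inQ : Q →ₗ[R] M := e.toLinearEquiv.toLinearMap ∘ₗ LinearMap.inl R Q (Module.Dual R P × P)

/-- The inclusion of `P` in `M = Q ⊥ H(P)`. -/
def inP : P →ₗ[R] M := e.toLinearEquiv.toLinearMap ∘ₗ LinearMap.inr R Q (Module.Dual R P × P) ∘ₗ
  LinearMap.inr R (Module.Dual R P) P

/-- The inclusion of `P^*` in `M = Q ⊥ H(P)`. -/
def inDual : Module.Dual R P →ₗ[R] M := e.toLinearEquiv.toLinearMap ∘ₗ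
  LinearMap.inr R Q (Module.Dual R P × P) ∘ₗ LinearMap.inl R (Module.Dual R P) P

lemma inQ_apply (z : Q) : inQ e z = e (z, (0, 0)) := rfl

lemma inP_apply (p : P) : inP e p = e (0, (0, p)) := rfl

lemma inDual_apply (f : Module.Dual R P) : inDual e f = e (0, (f, 0)) := rfl

lemma exists_apply_eq (x : M) : ∃ y, e y = x := e.toLinearEquiv.surjective x

lemma apply_eq_add (y : Q × (Module.Dual R P × P)) :
    e y = inQ e y.1 + inP e y.2.2 + inDual e y.2.1 := by
  rw [inQ_apply, inP_apply, inDual_apply, ← map_add, ← map_add]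
  simp

lemma sumHyp_apply (y : Q × (Module.Dual R P × P)) : sumHyp P q y = q y.1 + y.2.1 y.2.2 := rfl

lemma map_isometryEquiv (y : Q × (Module.Dual R P × P)) : q' (e y) = q y.1 + y.2.1 y.2.2 :=
  e.map_app y

lemma polarBilin_isometryEquiv (x y : Q × (Module.Dual R P × P)) :
    q'.polarBilin (e x) (e y) = q.polarBilin x.1 y.1 + (x.2.1 y.2.2 + y.2.1 x.2.2) := by
  have h1 := map_isometryEquiv e (x + y)
  rw [map_add e, map_add_polarBilin, map_isometryEquiv, map_isometryEquiv, Prod.fst_add,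
    map_add_polarBilin, Prod.snd_add, Prod.fst_add, Prod.snd_add, LinearMap.add_apply, map_add,
    map_add] at h1
  linear_combination h1

lemma polarBilin_inQ (z : Q) (y : Q × (Module.Dual R P × P)) :
    q'.polarBilin (inQ e z) (e y) = q.polarBilin z y.1 := by
  simp [inQ_apply, polarBilin_isometryEquiv, -QuadraticMap.polarBilin_apply_apply]

lemma polarBilin_inP (p : P) (y : Q × (Module.Dual R P × P)) :
    q'.polarBilin (inP e p) (e y) = y.2.1 p := by
  simp [inP_apply, polarBilin_isometryEquiv, -QuadraticMap.polarBilin_apply_apply]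

lemma polarBilin_inDual (f : Module.Dual R P) (y : Q × (Module.Dual R P × P)) :
    q'.polarBilin (inDual e f) (e y) = f y.2.2 := by
  simp [inDual_apply, polarBilin_isometryEquiv, -QuadraticMap.polarBilin_apply_apply]

lemma polarBilin_inQ_inQ (z w : Q) :
    q'.polarBilin (inQ e z) (inQ e w) = q.polarBilin z w := polarBilin_inQ e z _

lemma polarBilin_inP_inQ (p : P) (z : Q) : q'.polarBilin (inP e p) (inQ e z) = 0 :=
  polarBilin_inP e p _

lemma polarBilin_inDual_inQ (f : Module.Dual R P) (z : Q) :
    q'.polarBilin (inDual e f) (inQ e z) = 0 :=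
  (polarBilin_inDual e f _).trans (map_zero f)

lemma polarBilin_inP_inP (p p' : P) : q'.polarBilin (inP e p) (inP e p') = 0 :=
  polarBilin_inP e p _

lemma polarBilin_inDual_inDual (f f' : Module.Dual R P) :
    q'.polarBilin (inDual e f) (inDual e f') = 0 :=
  (polarBilin_inDual e f _).trans (map_zero f)

lemma polarBilin_inP_inDual (p : P) (f : Module.Dual R P) :
    q'.polarBilin (inP e p) (inDual e f) = f p := polarBilin_inP e p _

lemma map_inQ (z : Q) : q' (inQ e z) = q z := by
  rw [inQ_apply, map_isometryEquiv]
  simp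

lemma map_inP (p : P) : q' (inP e p) = 0 := by
  rw [inP_apply, map_isometryEquiv]
  simp

lemma map_inDual (f : Module.Dual R P) : q' (inDual e f) = 0 := by
  rw [inDual_apply, map_isometryEquiv]
  simp

/-- A non-degenerate `Q` and the reflexivity of `P` make the form of `M` non-degenerate. -/
lemma exists_polarBilin_eq_one [Module.IsReflexive R P]
    (e : QuadraticMap.IsometryEquiv (sumHyp P q) q') (hq : IsNondegenerate q) {u : M}
    (hu : IsUnimodular R u) : ∃ d, q'.polarBilin u d = 1 := by
  obtain ⟨f, hf⟩ := hu
  obtain ⟨z, hz⟩ := hq.2 (f ∘ₗ inQ e)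
  obtain ⟨p, hp⟩ := (Module.bijective_dual_eval R P).2 (f ∘ₗ inDual e)
  obtain ⟨y, rfl⟩ := exists_apply_eq e u
  refine ⟨e (z, (f ∘ₗ inP e, p)), ?_⟩
  have h1 : q.polarBilin y.1 z = f (inQ e y.1) := by
    rw [polarBilin_comm, hz, LinearMap.comp_apply]
  have h2 : y.2.1 p = f (inDual e y.2.1) := LinearMap.congr_fun hp y.2.1
  rw [polarBilin_isometryEquiv, h1, h2, ← hf, apply_eq_add e y, map_add, map_add,
    LinearMap.comp_apply]
  ring

lemma exists_notMem_pairing [Module.Finite R Q] [Module.Projective R Q]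
    (hq : IsNondegenerate q) {n : ℕ} (𝔭 : PrimeSpectrum R)
    (hn : Module.rankAtStalk Q 𝔭 = n) : ∃ s ∉ 𝔭.asIdeal, ∃ z z' : Fin n → Q,
      ∀ i j, q.polarBilin (z i) (z' j) = if i = j then s else 0 := by
  obtain ⟨s, hs, x, ξ, h, -⟩ := exists_dualBasis_of_rankAtStalk 𝔭 hn
  choose z' hz' using fun j => hq.2 (ξ j)
  exact ⟨s, hs, x, z', fun i j => by rw [polarBilin_comm, hz', h]⟩

lemma hypSplitting_inQ [Module.Finite R Q] [Module.Projective R Q] [Module.Finite R P]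
    [Module.Projective R P] (hq : IsNondegenerate q) {n m : ℕ} (hn : 1 ≤ n)
    (hQ : ∀ p : PrimeSpectrum R, Module.rankAtStalk Q p = n)
    (hP : ∀ p : PrimeSpectrum R, Module.rankAtStalk P p = m) :
    HypSplitting q' (LinearMap.range (inQ e)) (LinearMap.range (inP e))
      (LinearMap.range (inDual e)) m where
  isotropic_left := by
    rintro _ ⟨p, rfl⟩
    exact map_inP e p
  isotropic_right := by
    rintro _ ⟨f, rfl⟩
    exact map_inDual e f
  orth_left := by
    rintro _ ⟨p, rfl⟩ _ ⟨z, rfl⟩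
    exact polarBilin_inP_inQ e p z
  orth_right := by
    rintro _ ⟨f, rfl⟩ _ ⟨z, rfl⟩
    exact polarBilin_inDual_inQ e f z
  exists_add x := by
    obtain ⟨y, rfl⟩ := exists_apply_eq e x
    exact ⟨_, ⟨y.1, rfl⟩, _, ⟨y.2.2, rfl⟩, _, ⟨y.2.1, rfl⟩, apply_eq_add e y⟩
  unitTrace 𝔪 h𝔪 := by
    obtain ⟨s, hs, z, z', h⟩ := exists_notMem_pairing hq ⟨𝔪, h𝔪.isPrime⟩ (hQ _)
    let i : Fin n := ⟨0, hn⟩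
    refine ⟨_, ⟨z i, rfl⟩, _, ⟨z' i, rfl⟩, ?_⟩
    rw [polarBilin_inQ_inQ, h, if_pos rfl]
    exact hs
  exists_dualBasis 𝔪 h𝔪 := by
    obtain ⟨s, hs, x, ξ, h, hsum⟩ :=
      exists_dualBasis_of_rankAtStalk (X := P) ⟨𝔪, h𝔪.isPrime⟩ (hP _)
    refine ⟨s, hs, fun i => inP e (x i), fun i => inDual e (ξ i), fun i => ⟨_, rfl⟩,
      fun i => ⟨_, rfl⟩, fun i j => ?_, ?_, ?_⟩
    · rw [polarBilin_inP_inDual, h]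
    · rintro _ ⟨p, rfl⟩
      simp only [polarBilin_inP_inDual, ← map_smul, ← map_sum, hsum]
    · rintro _ ⟨f, rfl⟩
      have h1 : s • f = ∑ i, f (x i) • ξ i := by
        ext p
        rw [LinearMap.smul_apply, ← map_smul, hsum, map_sum, LinearMap.sum_apply]
        exact Finset.sum_congr rfl fun i _ => by
          rw [map_smul, LinearMap.smul_apply, smul_eq_mul, smul_eq_mul, mul_comm]
      simp only [polarBilin_comm q' (inDual e f), polarBilin_inP_inDual, ← map_smul, ← map_sum, h1]

/-- The complement of a hyperbolic family of rank `m` has rank `n ≥ 1`, so its form has unit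
trace. -/
lemma hasUnitTrace_hypCompl (e : QuadraticMap.IsometryEquiv (sumHyp P q) q')
    [Module.Finite R Q] [Module.Projective R Q] [Module.Finite R P]
    [Module.Projective R P] (hq : IsNondegenerate q) {n m : ℕ} (hn : 1 ≤ n)
    (hQ : ∀ p : PrimeSpectrum R, Module.rankAtStalk Q p = n)
    (hP : ∀ p : PrimeSpectrum R, Module.rankAtStalk P p = m) {a b : Fin m → M}
    (haa : ∀ i j, q'.polarBilin (a i) (a j) = 0) (hbb : ∀ i j, q'.polarBilin (b i) (b j) = 0)
    (hab : ∀ i j, q'.polarBilin (a i) (b j) = if i = j then 1 else 0) :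
    HasUnitTrace q' (hypCompl q' a b) := by
  intro 𝔪 h𝔪
  obtain ⟨s, hs, z, z', h⟩ := exists_notMem_pairing hq ⟨𝔪, h𝔪.isPrime⟩ (hQ _)
  obtain ⟨t, ht, x, ξ, h', -⟩ :=
    exists_dualBasis_of_rankAtStalk (X := P) ⟨𝔪, h𝔪.isPrime⟩ (hP _)
  let v : Fin n ⊕ (Fin m ⊕ Fin m) → M :=
    Sum.elim (fun i => inQ e (z i)) (Sum.elim (fun i => inP e (x i)) fun i => inDual e (ξ i))
  let w : Fin n ⊕ (Fin m ⊕ Fin m) → M := Sum.elim (fun i => t • inQ e (z' i))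
    (Sum.elim (fun i => s • inDual e (ξ i)) fun i => s • inP e (x i))
  have hvw : ∀ i j, q'.polarBilin (v i) (w j) = if i = j then s * t else 0 := by
    have h1 : ∀ f p, q'.polarBilin (inDual e f) (inP e p) = f p := fun f p => by
      rw [polarBilin_comm, polarBilin_inP_inDual]
    have h2 : ∀ f z, q'.polarBilin (inQ e z) (inDual e f) = 0 := fun f z => by
      rw [polarBilin_comm, polarBilin_inDual_inQ]
    have h3 : ∀ p z, q'.polarBilin (inQ e z) (inP e p) = 0 := fun p z => by
      rw [polarBilin_comm, polarBilin_inP_inQ]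
    rintro (i | i | i) (j | j | j) <;>
      simp only [v, w, Sum.elim_inl, Sum.elim_inr, map_smul, polarBilin_inQ_inQ, h, h', h1, h2,
        h3, polarBilin_inP_inDual, polarBilin_inP_inP, polarBilin_inP_inQ, polarBilin_inDual_inQ,
        polarBilin_inDual_inDual, smul_eq_mul, mul_ite, mul_zero, Sum.inl.injEq, Sum.inr.injEq,
        reduceCtorEq, if_false, mul_comm t s]
    simp only [eq_comm]
  exact exists_polarBilin_notMem
    (by simp only [Fintype.card_sum, Fintype.card_fin]; omega) 𝔪 h𝔪
    (fun hmem => (h𝔪.isPrime.mem_or_mem hmem).elim hs ht) v w hvw a b haa hbb hab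

variable (hq : IsNondegenerate q)

lemma dIso_apply (z w : Q) : dIso q hq z w = q.polarBilin z w := rfl

lemma polarBilin_starAlpha (α : Q →ₗ[R] P) (f : Module.Dual R P) (z : Q) :
    q.polarBilin (starAlpha q hq α f) z = f (α z) := by
  rw [← dIso_apply hq, starAlpha, LinearMap.comp_apply, LinearEquiv.coe_coe,
    LinearEquiv.apply_symm_apply]
  rfl

lemma polarBilin_starBeta (β : Q →ₗ[R] Module.Dual R P) (x : P) (z : Q) :
    q.polarBilin (starBeta q hq β x) z = β z x := by
  rw [← dIso_apply hq, starBeta, LinearMap.comp_apply, LinearEquiv.coe_coe,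
    LinearEquiv.apply_symm_apply]
  rfl

lemma eq_of_polarBilin_eq (hq : IsNondegenerate q) {z w : Q}
    (h : ∀ x, q.polarBilin z x = q.polarBilin w x) : z = w :=
  hq.1 (LinearMap.ext h)

variable [Invertible (2 : R)]

lemma half_mul_polarBilin_self (z : Q) : ⅟(2 : R) * q.polarBilin z z = q z := by
  rw [polarBilin_self, invOf_mul_cancel_left]

/-- `E_α` is an isometry. -/
lemma sumHyp_dserAlpha (α : Q →ₗ[R] P) (y : Q × (Module.Dual R P × P)) :
    sumHyp P q (dserAlpha q hq α y) = sumHyp P q y := by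
  set w := starAlpha q hq α y.2.1 with hw
  have h1 : y.2.1 (α y.1) = q.polarBilin y.1 w := by
    rw [polarBilin_comm, hw, polarBilin_starAlpha]
  have h2 : y.2.1 (α w) = q.polarBilin w w := by
    conv_rhs => rw [hw, polarBilin_starAlpha, ← hw]
  simp only [sumHyp_apply, dserAlpha, ← hw]
  rw [sub_eq_add_neg, map_add_polarBilin, QuadraticMap.map_neg, map_neg, map_sub, map_add,
    map_smul, h1, h2, smul_eq_mul, half_mul_polarBilin_self]
  ring

/-- `E^*_β` is an isometry. -/
lemma sumHyp_dserBeta (β : Q →ₗ[R] Module.Dual R P) (y : Q × (Module.Dual R P × P)) :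
    sumHyp P q (dserBeta q hq β y) = sumHyp P q y := by
  set w := starBeta q hq β y.2.2 with hw
  have h1 : β y.1 y.2.2 = q.polarBilin y.1 w := by
    rw [polarBilin_comm, hw, polarBilin_starBeta]
  have h2 : β w y.2.2 = q.polarBilin w w := by
    conv_rhs => rw [hw, polarBilin_starBeta, ← hw]
  simp only [sumHyp_apply, dserBeta, ← hw]
  rw [sub_eq_add_neg, map_add_polarBilin, QuadraticMap.map_neg, map_neg, LinearMap.sub_apply,
    LinearMap.add_apply, LinearMap.smul_apply, h1, h2, smul_eq_mul, half_mul_polarBilin_self]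
  ring

lemma isometricAction_dser (I : Ideal R) :
    IsometricAction q' (dser q hq e) (dserRel q hq e I) where
  map_apply := isometry_of_mem_closure fun g hg x => by
    obtain ⟨y, rfl⟩ := exists_apply_eq e x
    rcases hg with ⟨α, -, h⟩ | ⟨β, -, h⟩
    · rw [h, e.map_app, e.map_app, sumHyp_dserAlpha]
    · rw [h, e.map_app, e.map_app, sumHyp_dserBeta]
  conj_mem _ hg _ hn := normalClosureIn_conj_mem hg hn

lemma dserTrue_le_dser (I : Ideal R) : dserTrue q hq e I ≤ dser q hq e :=
  Subgroup.closure_mono (Set.union_subset_union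
    (fun _ ⟨α, h, h'⟩ => ⟨α, fun z => Submodule.smul_mono_left le_top (h z), h'⟩)
    (fun _ ⟨β, h, h'⟩ => ⟨β, fun z => Submodule.smul_mono_left le_top (h z), h'⟩))

/-- The transvection `σ_{p,k}` is `E_α` for `α = ⟨k, ·⟩ p`. -/
lemma esd_inP_inQ (p : P) (k : Q) (y : Q × (Module.Dual R P × P)) :
    esd q' (inP e p) (inQ e k) (e y) =
      e (dserAlpha q hq ((q.polarBilin k).smulRight p) y) := by
  have h1 : starAlpha q hq ((q.polarBilin k).smulRight p) y.2.1 = y.2.1 p • k :=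
    eq_of_polarBilin_eq hq fun z => by
      rw [polarBilin_starAlpha, LinearMap.smulRight_apply, map_smul, map_smul,
        LinearMap.smul_apply, smul_eq_mul, smul_eq_mul, mul_comm]
  rw [esd, polarBilin_inQ, polarBilin_inP, map_inQ, inP_apply, inQ_apply]
  simp only [← map_smul e, ← map_add e, ← map_sub e, dserAlpha, h1]
  refine congrArg e (Prod.ext ?_ (Prod.ext ?_ ?_))
  · simp
  · simp
  · simp only [Prod.snd_sub, Prod.snd_add, Prod.smul_snd, smul_zero, sub_zero,
      LinearMap.smulRight_apply, map_smul, ← half_mul_polarBilin_self]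
    module

/-- The transvection `σ_{f,k}` is `E^*_β` for `β = ⟨k, ·⟩ f`. -/
lemma esd_inDual_inQ (f : Module.Dual R P) (k : Q) (y : Q × (Module.Dual R P × P)) :
    esd q' (inDual e f) (inQ e k) (e y) =
      e (dserBeta q hq ((q.polarBilin k).smulRight f) y) := by
  have h1 : starBeta q hq ((q.polarBilin k).smulRight f) y.2.2 = f y.2.2 • k :=
    eq_of_polarBilin_eq hq fun z => by
      rw [polarBilin_starBeta, LinearMap.smulRight_apply, map_smul, LinearMap.smul_apply,
        LinearMap.smul_apply, smul_eq_mul, smul_eq_mul, mul_comm]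
  rw [esd, polarBilin_inQ, polarBilin_inDual, map_inQ, inDual_apply, inQ_apply]
  simp only [← map_smul e, ← map_add e, ← map_sub e, dserBeta, h1]
  refine congrArg e (Prod.ext ?_ (Prod.ext ?_ ?_))
  · simp
  · simp only [Prod.snd_sub, Prod.snd_add, Prod.smul_snd, Prod.fst_sub, Prod.fst_add,
      Prod.smul_fst, smul_zero, sub_zero,
      LinearMap.smulRight_apply, map_smul, ← half_mul_polarBilin_self]
    module
  · simp

lemma isRootPair_inP (I : Ideal R) (p : P) : IsRootPair q' (LinearMap.range (inQ e))
    (dser q hq e) (dserRel q hq e I) I (inP e p) := by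
  have h0 : ∀ k ∈ LinearMap.range (inQ e), q'.polarBilin (inP e p) k = 0 := by
    rintro _ ⟨z, rfl⟩
    exact polarBilin_inP_inQ e p z
  have h1 : ∀ J : Ideal R, ∀ k ∈ LinearMap.range (inQ e), ∀ r ∈ J,
      HasEsd q' (dserTrue q hq e J) (inP e p) (r • k) := by
    rintro J _ ⟨z, rfl⟩ r hr
    rw [← map_smul]
    refine ⟨esdEquiv q' _ _ (map_inP e p) (polarBilin_inP_inQ e p (r • z)),
      Subgroup.subset_closure (Or.inl ⟨_, fun x => ?_, esd_inP_inQ e hq p (r • z)⟩), fun x => rfl⟩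
    rw [LinearMap.smulRight_apply, map_smul, LinearMap.smul_apply, smul_assoc]
    exact Submodule.smul_mem_smul hr trivial
  exact ⟨⟨map_inP e p, h0, fun k hk r hr => (h1 I k hk r hr).mono
    (le_normalClosureIn (dserTrue_le_dser e hq I))⟩, ⟨map_inP e p, h0, h1 ⊤⟩⟩

lemma isRootPair_inDual (I : Ideal R) (f : Module.Dual R P) :
    IsRootPair q' (LinearMap.range (inQ e))
      (dser q hq e) (dserRel q hq e I) I (inDual e f) := by
  have h0 : ∀ k ∈ LinearMap.range (inQ e), q'.polarBilin (inDual e f) k = 0 := by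
    rintro _ ⟨z, rfl⟩
    exact polarBilin_inDual_inQ e f z
  have h1 : ∀ J : Ideal R, ∀ k ∈ LinearMap.range (inQ e), ∀ r ∈ J,
      HasEsd q' (dserTrue q hq e J) (inDual e f) (r • k) := by
    rintro J _ ⟨z, rfl⟩ r hr
    rw [← map_smul]
    refine ⟨esdEquiv q' _ _ (map_inDual e f) (polarBilin_inDual_inQ e f (r • z)),
      Subgroup.subset_closure (Or.inr ⟨_, fun x => ?_, esd_inDual_inQ e hq f (r • z)⟩),
      fun x => rfl⟩
    rw [LinearMap.smulRight_apply, map_smul, LinearMap.smul_apply, smul_assoc]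
    exact Submodule.smul_mem_smul hr trivial
  exact ⟨⟨map_inDual e f, h0, fun k hk r hr => (h1 I k hk r hr).mono
    (le_normalClosureIn (dserTrue_le_dser e hq I))⟩, ⟨map_inDual e f, h0, h1 ⊤⟩⟩

variable {N : Subgroup (M ≃ₗ[R] M)} {I : Ideal R} [Module.Finite R Q] [Module.Projective R Q]

/-- A unipotent map attached to `A : Q → IX`, where the totally isotropic summand `X` of `M` is
given by the inclusion `j`: it lies in `N` if the transvections along `X` do. -/
lemma mem_of_unipotent {X : Type*} [AddCommGroup X] [Module R X] [Module.Finite R X]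
    (hq : IsNondegenerate q) (j : X →ₗ[R] M) (hj : ∀ x, q' (j x) = 0)
    (hjj : ∀ x x', q'.polarBilin (j x) (j x') = 0)
    (hjQ : ∀ x z, q'.polarBilin (j x) (inQ e z) = 0)
    (hN : ∀ x v, (∀ x', q'.polarBilin (j x') v = 0) → ∀ r ∈ I, HasEsd q' N (j x) (r • v))
    (A : Q →ₗ[R] X) (hA : ∀ z, A z ∈ I • (⊤ : Submodule R X)) (B : M → Q)
    (hB : ∀ y z, q.polarBilin (B y) z = q'.polarBilin (j (A z)) y)
    {g : M ≃ₗ[R] M} (hg : ∀ y, g (e y) = e y + j (A y.1) - inQ e (B (e y)) -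
      ⅟(2 : R) • j (A (B (e y)))) : g ∈ N := by
  obtain ⟨k, l, w, r, p, hr, hsum⟩ := exists_sum_of_forall_mem hq I A hA
  obtain ⟨g', hg', h⟩ := exists_mem_unipotent (q := q') (N := N) (fun i => j (p i))
    (fun i => inQ e (r i • w i)) (fun i => hj _) (fun i i' => hjj _ _) (fun i i' => hjQ _ _)
    (fun i => by
      rw [map_smul]
      exact hN _ _ (fun x => hjQ x _) _ (hr i))
    (fun i i' => by
      have h1 : (⅟(2 : R) * q'.polarBilin (inQ e (r i' • w i')) (inQ e (r i • w i))) • j (p i') =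
          r i • (⅟(2 : R) * q'.polarBilin (inQ e (r i' • w i')) (inQ e (w i))) • j (p i') := by
        rw [map_smul (inQ e) (r i), map_smul, smul_eq_mul, smul_smul]
        congr 1
        ring
      rw [h1]
      exact hN _ _ (fun x => by rw [map_smul, hjj, smul_zero]) _ (hr i)) Finset.univ
  have h1 : ∀ y, sumTensor q' Finset.univ (fun i => j (p i)) (fun i => inQ e (r i • w i)) (e y) =
      j (A y.1) := fun y => by
    rw [sumTensor_apply, hsum, map_sum]
    simp only [polarBilin_inQ, map_smul j]
  have h2 : ∀ y, sumTensor q' Finset.univ (fun i => inQ e (r i • w i)) (fun i => j (p i)) y =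
      inQ e (B y) := fun y => by
    rw [sumTensor_apply]
    simp only [← map_smul (inQ e), ← map_sum]
    congr 1
    refine eq_of_polarBilin_eq hq fun z => ?_
    rw [hB, hsum, map_sum, map_sum, map_sum, LinearMap.sum_apply, LinearMap.sum_apply]
    refine Finset.sum_congr rfl fun i _ => ?_
    simp only [map_smul, LinearMap.smul_apply, smul_eq_mul]
    ring
  have h3 : g = g' := by
    refine LinearEquiv.ext fun x => ?_
    obtain ⟨y, rfl⟩ := exists_apply_eq e x
    rw [h, hg, h1, h2, inQ_apply e (B (e y)), h1]
  exact h3 ▸ hg'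

/-- The relative DSER generators lie in every group that contains the transvections along `P` and
along `P^*` with arguments in `I u^⊥`. -/
lemma dserTrue_le [Module.Finite R P] [Module.Projective R P]
    (h₁ : ∀ p v, (∀ p', q'.polarBilin (inP e p') v = 0) → ∀ r ∈ I,
      HasEsd q' N (inP e p) (r • v))
    (h₂ : ∀ f v, (∀ f', q'.polarBilin (inDual e f') v = 0) → ∀ r ∈ I,
      HasEsd q' N (inDual e f) (r • v)) : dserTrue q hq e I ≤ N := by
  rw [dserTrue, Subgroup.closure_le]
  rintro g (⟨α, hα, hg⟩ | ⟨β, hβ, hg⟩)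
  · refine mem_of_unipotent e hq (inP e) (map_inP e) (polarBilin_inP_inP e)
      (polarBilin_inP_inQ e) h₁ α hα (fun x => starAlpha q hq α (e.symm x).2.1)
      (fun x z => ?_) fun y => ?_
    · obtain ⟨y, rfl⟩ := exists_apply_eq e x
      rw [e.symm_apply_apply, polarBilin_starAlpha, polarBilin_inP]
    · rw [hg, e.symm_apply_apply, inP_apply, inP_apply, inQ_apply, ← map_smul e, ← map_add e,
        ← map_sub e, ← map_sub e]
      exact congrArg e (Prod.ext (by simp [dserAlpha]) (Prod.ext (by simp [dserAlpha])
        (by simp [dserAlpha])))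
  · refine mem_of_unipotent e hq (inDual e) (map_inDual e) (polarBilin_inDual_inDual e)
      (polarBilin_inDual_inQ e) h₂ β hβ (fun x => starBeta q hq β (e.symm x).2.2)
      (fun x z => ?_) fun y => ?_
    · obtain ⟨y, rfl⟩ := exists_apply_eq e x
      rw [e.symm_apply_apply, polarBilin_starBeta, polarBilin_inDual]
    · rw [hg, e.symm_apply_apply, inDual_apply, inDual_apply, inQ_apply, ← map_smul e,
        ← map_add e, ← map_sub e, ← map_sub e]
      exact congrArg e (Prod.ext (by simp [dserBeta]) (Prod.ext (by simp [dserBeta])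
        (by simp [dserBeta])))

end Dser
end QuadSpace

theorem mainTheorem2 {R Q P M : Type*} [CommRing R] [Invertible (2 : R)]
    [AddCommGroup Q] [Module R Q] [Module.Finite R Q] [Module.Projective R Q]
    [AddCommGroup P] [Module R P] [Module.Finite R P] [Module.Projective R P]
    [AddCommGroup M] [Module R M]
    (I : Ideal R) (n m : ℕ) (hn : 1 ≤ n) (hm : 2 ≤ m)
    (q : QuadraticForm R Q) (hq : QuadSpace.IsNondegenerate q)
    (hQ : ∀ p : PrimeSpectrum R, Module.rankAtStalk Q p = n)
    (hP : ∀ p : PrimeSpectrum R, Module.rankAtStalk P p = m)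
    -- the form `⟨,⟩_φ'` on `M = Q ⊥ H(P)`
    (q' : QuadraticForm R M)
    (e : QuadraticMap.IsometryEquiv (QuadSpace.sumHyp P q) q')
    (hyp : QuadSpace.HyperbolicRankGE q' m)
    -- it is locally given by a matrix congruent to the standard one
    (φ' : Matrix (Fin (n + 2 * m)) (Fin (n + 2 * m)) R)
    (ε : GL (Fin (n + 2 * m)) R)
    (hφ' : φ' = (ε : Matrix (Fin (n + 2 * m)) (Fin (n + 2 * m)) R).transpose *
      stdForm R (n + 2 * m) * (ε : Matrix (Fin (n + 2 * m)) (Fin (n + 2 * m)) R))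
    (hloc : ∀ (𝔪 : Ideal R) [𝔪.IsMaximal], QuadSpace.LocallyHasMatrix q' φ' 𝔪) :
    QuadSpace.transORel q' I = QuadSpace.dserRel q hq e I := by
  open QuadSpace in
  have hS := hypSplitting_inQ e hq hn hQ hP
  obtain ⟨a, b, ha, hb, haa, hbb, hab⟩ := exists_hyperbolic_basis hyp
  have hba : ∀ i j, q'.polarBilin (b i) (a j) = if i = j then 1 else 0 := fun i j => by
    rw [polarBilin_comm, hab]
    simp only [eq_comm]
  have htr := hasUnitTrace_hypCompl e hq hn hQ hP haa hbb hab
  have hS' := hypSplitting_hypCompl ha hb haa hbb hab htr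
  have hA : ∀ J : Ideal R, transOTrue q' J ≤ dserRel q hq e J := fun J => by
    have hloc : LocallyHasEsd q' (dserRel q hq e J) J :=
      hS.locallyHasEsd hm (isometricAction_dser e hq J)
        (by rintro _ ⟨p, rfl⟩; exact isRootPair_inP e hq J p)
        (by rintro _ ⟨f, rfl⟩; exact isRootPair_inDual e hq J f)
    rw [transOTrue, Subgroup.closure_le]
    rintro g ⟨u, v, hu, hqu, huv, hv, hg⟩
    obtain ⟨d, hd⟩ := exists_polarBilin_eq_one e hq hu
    exact (hloc.hasEsd_of_unimodular hqu hd hv huv).mem hg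
  have hB : ∀ J : Ideal R, dserTrue q hq e J ≤ transORel q' J := fun J => by
    have hloc : LocallyHasEsd q' (transORel q' J) J :=
      hS'.locallyHasEsd hm (isometricAction_transO q' J)
        (fun x hx => isRootPair_of_mem_span ha haa hab
          (fun i k hk => (mem_hypCompl.1 hk i).1) htr hx)
        (fun x hx => isRootPair_of_mem_span hb hbb hba
          (fun i k hk => (mem_hypCompl.1 hk i).2) htr hx)
    exact dserTrue_le e hq
      (fun p v hv r hr => hloc.hasEsd_of_isotropic hS ⟨p, rfl⟩
        (by rintro _ ⟨p', rfl⟩; exact hv p') hr)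
      (fun f v hv r hr => hloc.hasEsd_of_isotropic hS.symm ⟨f, rfl⟩
        (by rintro _ ⟨f', rfl⟩; exact hv f') hr)
  have hG : transO q' = dser q hq e := le_antisymm
    ((hA ⊤).trans_eq normalClosureIn_self) ((hB ⊤).trans_eq normalClosureIn_self)
  refine le_antisymm (normalClosureIn_le (hA I) fun g hg _ hn => ?_)
    (normalClosureIn_le (hB I) fun g hg _ hn => ?_)
  · exact normalClosureIn_conj_mem (hG ▸ hg) hn
  · exact normalClosureIn_conj_mem (hG ▸ hg) hn
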